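/- Let $d_I\ge 1$, $d_O\ge 2$, $d_E\ge 1$ be integers with $d_I\le d_Od_E$. Let $V:\mathbb C^{d_I}\to\mathbb C^{d_O}\otimes\mathbb C^{d_E}$ be a Haar-random isometry (the first $d_I$ columns of a Haar-random unitary on $\mathbb C^{d_O}\otimes\mathbb C^{d_E}$), let $|V\rangle=\sum_i|i\rangle\otimes V|i\rangle$ be its Choi vector, and let $C=\operatorname{tr}_E|V\rangle\langle V|$ be the Choi operator of the random channel $X\mapsto\operatorname{tr}_E(VXV^*)$; $\mathbb E$ denotes the average over $V$. Let $c_1^\downarrow\ge c_2^\downarrow\ge\cdots\ge c_{d_Id_O}^\downarrow\ge 0$ be the eigenvalues of $C$ in non-increasing order, with multiplicity. For a density matrix $\rho_E$ on $\mathbb C^{d_E}$, the strategy that outputs $C\otimes\rho_E$ has average purification error $$\epsilon_{\mathrm{app}\text{-}\rho_E}=\mathbb E\Big[\min_{U_E}\big\|C\otimes\rho_E-(\mathbb 1\otimes U_E)|V\rangle\langle V|(\mathbb 1\otimes U_E^*)\big\|_2^2\Big],$$ where $U_E$ ranges over the unitaries on $\mathbb C^{d_E}$ and $\|\cdot\|_2$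 is the Hilbert–Schmidt norm. Put $\epsilon_{\mathrm{app}}=\min_{\rho_E}\epsilon_{\mathrm{app}\text{-}\rho_E}$, the minimum over all density matrices $\rho_E$ on $\mathbb C^{d_E}$. Then all these expectations are well defined, both minima are attained, and $$\mathbb E[\operatorname{tr}C^2]=\frac{d_Id_O(d_E^2-1)+d_I^2d_E(d_O^2-1)}{d_O^2d_E^2-1},$$ $$\epsilon_{\mathrm{app}}=d_I^2-\frac{\sum_i\big(\mathbb E[(c_i^\downarrow)^2]\big)^2}{\mathbb E[\operatorname{tr}C^2]} =d_I^2-\frac{d_O^2d_E^2-1}{d_Id_O(d_E^2-1)+d_I^2d_E(d_O^2-1)}\sum_i\big(\mathbb E[(c_i^\downarrow)^2]\big)^2 .$$ Moreover $$d_I^2-\frac{d_Id_O(d_E^2-1)+d_I^2d_E(d_O^2-1)}{d_O^2d_E^2-1}\;\le\;\epsilon_{\mathrm{app}}\;\le\; d_I^2-\frac1{d_E}\,\frac{d_Id_O(d_E^2-1)+d_I^2d_E(d_O^2-1)}{d_O^2d_E^2-1},$$ and the right-hand side is exactly the error $\epsilon_{\mathrm{app}\text{-}\mathbb 1/d_E}$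 of the strategy that appends the maximally mixed state $\rho_E=\mathbb 1/d_E$. -/

import Mathlib

open scoped Matrix Kronecker ComplexOrder
open MeasureTheory

namespace AppendEnv

/-! ### Choi operators, dilations, states -/

/-- The Choi vector `|V⟩ = ∑ᵢ |i⟩ ⊗ V|i⟩ ∈ H_I ⊗ H_O ⊗ H_E` of an operator
`V : H_I → H_O ⊗ H_E`. -/
def choiVec {dI dO dE : ℕ} (V : Matrix (Fin dO × Fin dE) (Fin dI) ℂ) :
    (Fin dI × Fin dO) × Fin dE → ℂ :=
  fun x => V (x.1.2, x.2) x.1.1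

/-- The rank-one Choi operator `|V⟩⟨V|` on `H_I ⊗ H_O ⊗ H_E`. -/
def choiProj {dI dO dE : ℕ} (V : Matrix (Fin dO × Fin dE) (Fin dI) ℂ) :
    Matrix ((Fin dI × Fin dO) × Fin dE) ((Fin dI × Fin dO) × Fin dE) ℂ :=
  Matrix.vecMulVec (choiVec V) (star (choiVec V))

/-- The partial trace over the second tensor factor. -/
def partialTraceRight {α β : Type*} [Fintype β] (M : Matrix (α × β) (α × β) ℂ) :
    Matrix α α ℂ :=
  Matrix.of fun a b => ∑ e, M (a, e) (b, e)

/-- The Choi operator `C = tr_E |V⟩⟨V|` on `H_I ⊗ H_O` of the channel with Stinespring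
operator `V`. -/
def choiOp {dI dO dE : ℕ} (V : Matrix (Fin dO × Fin dE) (Fin dI) ℂ) :
    Matrix (Fin dI × Fin dO) (Fin dI × Fin dO) ℂ :=
  partialTraceRight (choiProj V)

theorem choiOp_isHermitian {dI dO dE : ℕ} (V : Matrix (Fin dO × Fin dE) (Fin dI) ℂ) :
    (choiOp V).IsHermitian := by
  ext a b
  simp [choiOp, partialTraceRight, choiProj, Matrix.vecMulVec_apply, Matrix.conjTranspose_apply,
    mul_comm]

/-- The eigenvalues `c₀ ≥ c₁ ≥ ⋯` of `C`, listed with multiplicity in non-increasing order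
(there are `d_I d_O` of them, those beyond the rank of `C` being zero). -/
noncomputable def orderedEig {dI dO dE : ℕ} (V : Matrix (Fin dO × Fin dE) (Fin dI) ℂ)
    (i : Fin (Fintype.card (Fin dI × Fin dO))) : ℝ :=
  (choiOp_isHermitian V).eigenvalues₀ i

/-- The purity `tr (C²)`. -/
noncomputable def purity {dI dO dE : ℕ} (V : Matrix (Fin dO × Fin dE) (Fin dI) ℂ) : ℝ :=
  (Matrix.trace (choiOp V * choiOp V)).re

/-- The Choi operator `(𝟙 ⊗ U_E) |V⟩⟨V| (𝟙 ⊗ U_E)*` of the purification of `C` obtained from `V`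
by the environment unitary `U_E`. -/
noncomputable def rotatedProj {dI dO dE : ℕ} (V : Matrix (Fin dO × Fin dE) (Fin dI) ℂ)
    (U : Matrix.unitaryGroup (Fin dE) ℂ) :
    Matrix ((Fin dI × Fin dO) × Fin dE) ((Fin dI × Fin dO) × Fin dE) ℂ :=
  ((1 : Matrix (Fin dI × Fin dO) (Fin dI × Fin dO) ℂ) ⊗ₖ (U : Matrix (Fin dE) (Fin dE) ℂ)) *
    choiProj V *
    ((1 : Matrix (Fin dI × Fin dO) (Fin dI × Fin dO) ℂ) ⊗ₖ (U : Matrix (Fin dE) (Fin dE) ℂ))ᴴ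

/-- Density matrices on `ℂ^d`. -/
def densityMatrices (d : ℕ) : Set (Matrix (Fin d) (Fin d) ℂ) :=
  {ρ | ρ.PosSemidef ∧ ρ.trace = 1}

/-- The maximally mixed state `𝟙/d`. -/
noncomputable def maxMixed (d : ℕ) : Matrix (Fin d) (Fin d) ℂ :=
  ((d : ℂ)⁻¹) • (1 : Matrix (Fin d) (Fin d) ℂ)

/-- The squared Hilbert–Schmidt norm `‖M‖₂² = tr (M* M)`. -/
noncomputable def hsNormSq {α : Type*} [Fintype α] (M : Matrix α α ℂ) : ℝ :=
  (Matrix.trace (Mᴴ * M)).re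

/-! ### Haar-random Stinespring isometries -/

instance compactSpace_unitaryGroup {n : Type*} [Fintype n] [DecidableEq n] :
    CompactSpace (Matrix.unitaryGroup n ℂ) := by
  have hK : IsCompact (Set.pi Set.univ fun _ : n => Set.pi Set.univ fun _ : n =>
      Metric.closedBall (0 : ℂ) 1) :=
    isCompact_univ_pi fun _ => isCompact_univ_pi fun _ => isCompact_closedBall _ _
  have hc : IsCompact (Matrix.unitaryGroup n ℂ : Set (Matrix n n ℂ)) := by
    have hcl : IsClosed (Matrix.unitaryGroup n ℂ : Set (Matrix n n ℂ)) := isClosed_unitary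
    refine hK.of_isClosed_subset hcl ?_
    intro U hU i _ j _
    simpa using entry_norm_bound_of_unitary hU i j
  exact isCompact_iff_compactSpace.mp hc

/-- The Borel σ-algebra of the unitary group. -/
noncomputable instance measurableSpace_unitaryGroup {n : Type*} [Fintype n] [DecidableEq n] :
    MeasurableSpace (Matrix.unitaryGroup n ℂ) := borel _

instance borelSpace_unitaryGroup {n : Type*} [Fintype n] [DecidableEq n] :
    BorelSpace (Matrix.unitaryGroup n ℂ) := ⟨rfl⟩

/-- The Haar probability measure on the unitary group. -/
noncomputable def haarUnitary (n : Type*) [Fintype n] [DecidableEq n] :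
    Measure (Matrix.unitaryGroup n ℂ) :=
  Measure.haarMeasure ⊤

instance isProbabilityMeasure_haarUnitary {n : Type*} [Fintype n] [DecidableEq n] :
    IsProbabilityMeasure (haarUnitary n) :=
  ⟨by simpa [haarUnitary] using
    Measure.haarMeasure_self (K₀ := (⊤ : TopologicalSpace.PositiveCompacts
      (Matrix.unitaryGroup n ℂ)))⟩

/-- The first `d_I` columns of a unitary on `H_O ⊗ H_E`. -/
def firstColumns {dI dO dE : ℕ} (h : dI ≤ dO * dE)
    (U : Matrix.unitaryGroup (Fin dO × Fin dE) ℂ) : Matrix (Fin dO × Fin dE) (Fin dI) ℂ :=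
  Matrix.of fun x i =>
    (U : Matrix (Fin dO × Fin dE) (Fin dO × Fin dE) ℂ) x (finProdFinEquiv.symm (Fin.castLE h i))

/-- Expectation of `f V` over a Haar-random isometry `V : H_I → H_O ⊗ H_E`, i.e. the first `d_I`
columns of a Haar-random unitary. -/
noncomputable def haarExp {dI dO dE : ℕ} (h : dI ≤ dO * dE)
    (f : Matrix (Fin dO × Fin dE) (Fin dI) ℂ → ℝ) : ℝ :=
  ∫ U, f (firstColumns h U) ∂(haarUnitary (Fin dO × Fin dE))

/-- Integrability of `f V` for a Haar-random isometry `V`. -/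
def HaarIntegrable {dI dO dE : ℕ} (h : dI ≤ dO * dE)
    (f : Matrix (Fin dO × Fin dE) (Fin dI) ℂ → ℝ) : Prop :=
  Integrable (fun U => f (firstColumns h U)) (haarUnitary (Fin dO × Fin dE))

/-! ### Append-environment strategies and their errors -/

/-- The output `C ⊗ ρ_E` of the append-environment strategy on the input `C`. -/
def appendEnv {dI dO dE : ℕ} (ρ : Matrix (Fin dE) (Fin dE) ℂ)
    (C : Matrix (Fin dI × Fin dO) (Fin dI × Fin dO) ℂ) :
    Matrix ((Fin dI × Fin dO) × Fin dE) ((Fin dI × Fin dO) × Fin dE) ℂ :=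
  C ⊗ₖ ρ

/-- The squared Hilbert–Schmidt distance of the output to the purification given by `U`. -/
noncomputable def dist2 {dI dO dE : ℕ} (ρ : Matrix (Fin dE) (Fin dE) ℂ)
    (V : Matrix (Fin dO × Fin dE) (Fin dI) ℂ) (U : Matrix.unitaryGroup (Fin dE) ℂ) : ℝ :=
  hsNormSq (appendEnv ρ (choiOp V) - rotatedProj V U)

/-- The smallest squared distance of the output to a purification of the input. -/
noncomputable def bestDist2 {dI dO dE : ℕ} (ρ : Matrix (Fin dE) (Fin dE) ℂ)
    (V : Matrix (Fin dO × Fin dE) (Fin dI) ℂ) : ℝ :=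
  ⨅ U : Matrix.unitaryGroup (Fin dE) ℂ, dist2 ρ V U

/-- The average error of the strategy `C ↦ C ⊗ ρ_E`. -/
noncomputable def appError {dI dO dE : ℕ} (h : dI ≤ dO * dE)
    (ρ : Matrix (Fin dE) (Fin dE) ℂ) : ℝ :=
  haarExp h (bestDist2 ρ)

/-- The least average error over all append-environment strategies. -/
noncomputable def epsApp {dI dO dE : ℕ} (h : dI ≤ dO * dE) : ℝ :=
  sInf (appError h '' densityMatrices dE)

end AppendEnv

/-! Write `M` for the Choi vector as a matrix from the environment to input-output, so that `C = M
Mᴴ`, and put `G = Mᵀ (Mᵀ)ᴴ` on the environment. Expanding the square, the distance to the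
purification rotated by `U` is `tr C² · tr ρ² + ‖V‖⁴ - 2 Re tr (ρ U G² Uᴴ)` (`dist2_eq`). Only the
last term depends on `U`, and von Neumann's trace theorem (`isGreatest_re_trace_conj`) maximizes it:
the best value is `∑ a_k c_k²`, with the eigenvalues `a_k` of `ρ` and `c_k` of `C` both in
non-increasing order. Here `G` and `C` have the same spectrum up to zeros (`choiEig_eq_env`).

Averaging, with `m_k = E c_k²` and `p = E tr C² = ∑ m_k`, gives the quadratic `p ∑ a_k² + d_I² - 2 ∑
a_k m_k` in the ordered spectrum of `ρ` (`appError_eq`). Its unconstrained minimizer `a_k = m_k / p`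
is non-negative, non-increasing and of sum one, hence the spectrum of a state, and the minimum is
`d_I² - ∑ m_k² / p`. The lower bound is `∑ m_k² ≤ (∑ m_k)²`; the upper one is the value at the
maximally mixed state.

The closed form of `p` needs fourth moments of two columns of a Haar unitary. They follow from left
invariance alone (`haarMoment_values`): sign changes and permutations of rows leave three unknowns,
determined by one reflection identity and by orthonormality of the columns. -/

namespace AppendEnv

/-! ### Von Neumann's trace theorem -/

section TraceInequality

variable {n : Type*} [Fintype n] [DecidableEq n]

theorem re_trace_diagonal_conj (X : Matrix n n ℂ) (a b : n → ℝ) :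
    (Matrix.trace (Matrix.diagonal (fun i => (a i : ℂ)) *
      (X * Matrix.diagonal (fun i => (b i : ℂ)) * Xᴴ))).re =
      ∑ i, ∑ j, a i * (Complex.normSq (X i j) * b j) := by
  rw [Matrix.trace, Complex.re_sum]
  refine Finset.sum_congr rfl fun i _ => ?_
  rw [Matrix.diag_apply, Matrix.diagonal_mul, Matrix.mul_apply, Finset.mul_sum, Complex.re_sum]
  refine Finset.sum_congr rfl fun j _ => ?_
  rw [Matrix.mul_diagonal, Matrix.conjTranspose_apply]
  have : (a i : ℂ) * (X i j * (b j : ℂ) * star (X i j)) =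
      ((a i * (Complex.normSq (X i j) * b j) : ℝ) : ℂ) := by
    push_cast
    rw [← Complex.mul_conj]
    simp only [Complex.star_def]
    ring
  rw [this, Complex.ofReal_re]

theorem normSq_mem_doublyStochastic (X : Matrix.unitaryGroup n ℂ) :
    (Matrix.of fun i j => Complex.normSq ((X : Matrix n n ℂ) i j)) ∈ doublyStochastic ℝ n := by
  rw [mem_doublyStochastic_iff_sum]
  refine ⟨fun i j => Complex.normSq_nonneg _, fun i => ?_, fun j => ?_⟩
  · have h := congrFun (congrFun (Matrix.mem_unitaryGroup_iff.1 X.2) i) i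
    rw [Matrix.mul_apply, Matrix.one_apply_eq] at h
    have h' := congrArg Complex.re h
    simpa [Matrix.star_apply, Complex.mul_conj, ← Complex.ofReal_sum] using h'
  · have h := congrFun (congrFun (Matrix.mem_unitaryGroup_iff'.1 X.2) j) j
    rw [Matrix.mul_apply, Matrix.one_apply_eq] at h
    have h' := congrArg Complex.re h
    simpa [Matrix.star_apply, mul_comm, Complex.mul_conj, ← Complex.ofReal_sum] using h'

/-- By Birkhoff, `D` is a convex combination of permutation matrices; each of these obeys the
rearrangement inequality. -/
theorem sum_mul_doublyStochastic_le {D : Matrix n n ℝ} (hD : D ∈ doublyStochastic ℝ n)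
    {a b : n → ℝ} (hab : Monovary a b) :
    ∑ i, ∑ j, a i * (D i j * b j) ≤ ∑ i, a i * b i := by
  obtain ⟨w, hw0, hw1, rfl⟩ := exists_eq_sum_perm_of_mem_doublyStochastic hD
  calc ∑ i, ∑ j, a i * ((∑ σ, w σ • σ.permMatrix ℝ) i j * b j)
      = ∑ σ, w σ * ∑ i, a i * b (σ i) := by
        simp_rw [Matrix.sum_apply, Matrix.smul_apply, Equiv.Perm.permMatrix, smul_eq_mul,
          PEquiv.toMatrix_apply, Finset.sum_mul, Finset.mul_sum]
        rw [Finset.sum_congr rfl fun i _ => Finset.sum_comm, Finset.sum_comm]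
        refine Finset.sum_congr rfl fun σ _ => Finset.sum_congr rfl fun i _ => ?_
        rw [Finset.sum_eq_single (σ i)]
        · simp; ring
        · intro j _ hj; simp [hj.symm]
        · simp
    _ ≤ ∑ σ, w σ * ∑ i, a i * b i := by
        exact Finset.sum_le_sum fun σ _ =>
          mul_le_mul_of_nonneg_left hab.sum_mul_comp_perm_le_sum_mul (hw0 σ)
    _ = _ := by rw [← Finset.sum_mul, hw1, one_mul]

/-- **Von Neumann's trace theorem** for Hermitian matrices. -/
theorem isGreatest_re_trace_conj (P Q : Matrix.unitaryGroup n ℂ) {a b : n → ℝ}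
    (hab : Monovary a b) {A B : Matrix n n ℂ}
    (hA : A = (P : Matrix n n ℂ) * Matrix.diagonal (fun i => (a i : ℂ)) * (P : Matrix n n ℂ)ᴴ)
    (hB : B = (Q : Matrix n n ℂ) * Matrix.diagonal (fun i => (b i : ℂ)) * (Q : Matrix n n ℂ)ᴴ) :
    IsGreatest (Set.range fun U : Matrix.unitaryGroup n ℂ =>
      (Matrix.trace (A * ((U : Matrix n n ℂ) * B * (U : Matrix n n ℂ)ᴴ))).re) (∑ i, a i * b i) := by
  have key : ∀ U : Matrix.unitaryGroup n ℂ,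
      (Matrix.trace (A * ((U : Matrix n n ℂ) * B * (U : Matrix n n ℂ)ᴴ))).re =
        ∑ i, ∑ j, a i * (Complex.normSq ((P⁻¹ * U * Q : Matrix.unitaryGroup n ℂ).1 i j) * b j) := by
    intro U
    rw [← re_trace_diagonal_conj, hA, hB]
    congr 1
    have : ((P⁻¹ * U * Q : Matrix.unitaryGroup n ℂ) : Matrix n n ℂ) =
        (P : Matrix n n ℂ)ᴴ * U * Q := rfl
    rw [this, Matrix.mul_assoc (P : Matrix n n ℂ), Matrix.mul_assoc (P : Matrix n n ℂ),
      Matrix.trace_mul_comm]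
    simp only [Matrix.conjTranspose_mul, Matrix.conjTranspose_conjTranspose, Matrix.mul_assoc]
  constructor
  -- This unitary carries the eigenbasis of `B` onto that of `A`, so the doubly stochastic matrix in
  -- `key` becomes the identity.
  · refine ⟨P * Q⁻¹, ?_⟩
    simp only [key]
    refine Finset.sum_congr rfl fun i _ => ?_
    have : P⁻¹ * (P * Q⁻¹) * Q = 1 := by group
    rw [this, Finset.sum_eq_single i]
    · simp
    · intro j _ hj; simp [Matrix.one_apply_ne hj.symm]
    · simp
  · rintro _ ⟨U, rfl⟩
    simp only [key]
    exact sum_mul_doublyStochastic_le (normSq_mem_doublyStochastic _) hab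

end TraceInequality

/-! ### Ordered eigenvalues, padded by zeros -/

section EigSeq

variable {n : Type*} [Fintype n]

/-- The position of an index in the enumeration used to order eigenvalues. -/
noncomputable def eigIndex (i : n) : ℕ :=
  ((Fintype.equivOfCardEq (Fintype.card_fin (Fintype.card n)) : Fin (Fintype.card n) ≃ n).symm i : ℕ)

theorem sum_eigIndex (f : ℕ → ℝ) :
    ∑ i : n, f (eigIndex i) = ∑ k ∈ Finset.range (Fintype.card n), f k := by
  rw [← Fin.sum_univ_eq_sum_range]
  exact Equiv.sum_comp
    (Fintype.equivOfCardEq (Fintype.card_fin (Fintype.card n)) : Fin (Fintype.card n) ≃ n).symm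
    (fun k => f k)

variable [DecidableEq n] {A : Matrix n n ℂ}

/-- The eigenvalues of a Hermitian matrix in non-increasing order, continued by zeros. -/
noncomputable def eigSeq (hA : A.IsHermitian) (k : ℕ) : ℝ :=
  if hk : k < Fintype.card n then hA.eigenvalues₀ ⟨k, hk⟩ else 0

theorem eigSeq_of_le (hA : A.IsHermitian) {k : ℕ} (hk : Fintype.card n ≤ k) : eigSeq hA k = 0 :=
  dif_neg hk.not_gt

theorem eigSeq_fin (hA : A.IsHermitian) (k : Fin (Fintype.card n)) :
    eigSeq hA k = hA.eigenvalues₀ k := dif_pos k.2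

theorem eigSeq_eigIndex (hA : A.IsHermitian) (i : n) :
    eigSeq hA (eigIndex i) = hA.eigenvalues i :=
  eigSeq_fin hA _

theorem eigenvalues₀_nonneg (hA : A.PosSemidef) (k : Fin (Fintype.card n)) :
    0 ≤ hA.isHermitian.eigenvalues₀ k := by
  have := hA.eigenvalues_nonneg (Fintype.equivOfCardEq (Fintype.card_fin _) k)
  simpa [Matrix.IsHermitian.eigenvalues] using this

theorem eigSeq_nonneg (hA : A.PosSemidef) (k : ℕ) : 0 ≤ eigSeq hA.isHermitian k := by
  unfold eigSeq
  split_ifs with h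
  · exact eigenvalues₀_nonneg hA _
  · exact le_rfl

theorem eigSeq_antitone (hA : A.PosSemidef) : Antitone (eigSeq hA.isHermitian) := by
  intro k l hkl
  by_cases hl : l < Fintype.card n
  · rw [eigSeq, eigSeq, dif_pos hl, dif_pos (hkl.trans_lt hl)]
    exact hA.isHermitian.eigenvalues₀_antitone hkl
  · rw [eigSeq_of_le _ (not_lt.1 hl)]
    exact eigSeq_nonneg hA k

theorem exists_unitary_diagonalization (hA : A.IsHermitian) : ∃ P : Matrix.unitaryGroup n ℂ,
    A = (P : Matrix n n ℂ) * Matrix.diagonal (fun i => ((eigSeq hA (eigIndex i) : ℝ) : ℂ)) *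
      (P : Matrix n n ℂ)ᴴ := by
  refine ⟨hA.eigenvectorUnitary, ?_⟩
  simp_rw [eigSeq_eigIndex]
  exact hA.spectral_theorem

/-- This makes the sequence a function of the characteristic polynomial alone, so that matrices of
different sizes can be compared. -/
theorem eigSeq_eq_getD (hA : A.IsHermitian) (k : ℕ) :
    eigSeq hA k = ((A.charpoly.roots.map RCLike.re).sort (· ≥ ·)).getD k 0 := by
  rw [hA.sort_roots_charpoly_eq_eigenvalues₀]
  by_cases hk : k < Fintype.card n
  · simp [eigSeq, hk, List.getD]
  · simp [eigSeq, hk, List.getD]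

theorem sort_add_replicate_zero {S : Multiset ℝ} (hS : ∀ x ∈ S, 0 ≤ x) (m : ℕ) :
    (S + Multiset.replicate m 0).sort (· ≥ ·) = S.sort (· ≥ ·) ++ List.replicate m 0 := by
  refine List.Perm.eq_of_pairwise' (r := (· ≥ ·)) (Multiset.pairwise_sort _ _) ?_ ?_
  · rw [List.pairwise_append]
    refine ⟨Multiset.pairwise_sort _ _, List.pairwise_replicate.2 (Or.inr le_rfl), ?_⟩
    intro x hx y hy
    rw [List.eq_of_mem_replicate hy]
    exact hS x ((Multiset.mem_sort _).1 hx)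
  · rw [← Multiset.coe_eq_coe, Multiset.sort_eq, ← Multiset.coe_add, Multiset.sort_eq,
      Multiset.coe_replicate]

theorem getD_append_replicate_zero (l : List ℝ) (m k : ℕ) :
    (l ++ List.replicate m 0).getD k 0 = l.getD k 0 := by
  by_cases hk : k < l.length
  · rw [List.getD_append _ _ _ _ hk]
  · rw [List.getD_append_right _ _ _ _ (not_lt.1 hk), List.getD_eq_default l _ (not_lt.1 hk)]
    by_cases h : k - l.length < m
    · simp [List.getD, h]
    · simp [List.getD, h]

theorem re_roots_charpoly_nonneg (hA : A.PosSemidef) :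
    ∀ x ∈ A.charpoly.roots.map RCLike.re, (0 : ℝ) ≤ x := by
  intro x hx
  rw [hA.isHermitian.roots_charpoly_eq_eigenvalues] at hx
  simp only [Multiset.map_map, Multiset.mem_map] at hx
  obtain ⟨i, -, rfl⟩ := hx
  simpa using hA.eigenvalues_nonneg i

/-- The powers of `X` only add zero roots. As all roots are non-negative, these zeros are sorted to
the end, where they agree with the default value of `getD`. -/
theorem eigSeq_eq_of_charpoly {m : Type*} [Fintype m] [DecidableEq m] {B : Matrix m m ℂ}
    (hA : A.PosSemidef) (hB : B.PosSemidef) {p q : ℕ}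
    (h : Polynomial.X ^ p * A.charpoly = Polynomial.X ^ q * B.charpoly) :
    eigSeq hA.isHermitian = eigSeq hB.isHermitian := by
  have hroots : A.charpoly.roots.map RCLike.re + Multiset.replicate p (0 : ℝ) =
      B.charpoly.roots.map RCLike.re + Multiset.replicate q (0 : ℝ) := by
    have h' := congrArg (fun f : Polynomial ℂ => f.roots.map (RCLike.re : ℂ → ℝ)) h
    rw [Polynomial.roots_mul (mul_ne_zero (pow_ne_zero _ Polynomial.X_ne_zero)
        A.charpoly_monic.ne_zero),
      Polynomial.roots_mul (mul_ne_zero (pow_ne_zero _ Polynomial.X_ne_zero)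
        B.charpoly_monic.ne_zero), Polynomial.roots_X_pow, Polynomial.roots_X_pow] at h'
    simpa [Multiset.map_add, Multiset.nsmul_singleton, add_comm] using h'
  funext k
  rw [eigSeq_eq_getD, eigSeq_eq_getD, ← getD_append_replicate_zero _ p,
    ← sort_add_replicate_zero (re_roots_charpoly_nonneg hA), hroots,
    sort_add_replicate_zero (re_roots_charpoly_nonneg hB),
    getD_append_replicate_zero]

/-- Sums of eigenvalues with non-increasing weights depend continuously on the matrix. -/
theorem continuous_sum_mul_eigSeq {X : Type*} [TopologicalSpace X] {F : X → Matrix n n ℂ}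
    (hF : Continuous F) (hH : ∀ x, (F x).PosSemidef) {d : ℕ → ℝ} (hd : Antitone d) :
    Continuous fun x => ∑ k ∈ Finset.range (Fintype.card n), d k * eigSeq (hH x).isHermitian k := by
  have h1 : ∀ x, ∑ k ∈ Finset.range (Fintype.card n), d k * eigSeq (hH x).isHermitian k =
      sSup ((fun U : Matrix.unitaryGroup n ℂ => (Matrix.trace
        (Matrix.diagonal (fun i : n => ((d (eigIndex i) : ℝ) : ℂ)) *
          ((U : Matrix n n ℂ) * F x * (U : Matrix n n ℂ)ᴴ))).re) '' Set.univ) := by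
    intro x
    obtain ⟨Q, hQ⟩ := exists_unitary_diagonalization (hH x).isHermitian
    rw [← sum_eigIndex (n := n) (fun k => d k * eigSeq (hH x).isHermitian k), Set.image_univ]
    refine (IsGreatest.csSup_eq (isGreatest_re_trace_conj 1 Q ?_ (by simp) hQ)).symm
    exact (hd.monovary (eigSeq_antitone (hH x))).comp_right eigIndex
  simp_rw [h1]
  -- The weighted sum is now a supremum over the compact unitary group of a jointly continuous
  -- function.
  refine isCompact_univ.continuous_sSup ?_
  refine Complex.continuous_re.comp (Continuous.matrix_trace ?_)
  have hU : Continuous fun p : X × Matrix.unitaryGroup n ℂ => (p.2 : Matrix n n ℂ) :=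
    continuous_subtype_val.comp continuous_snd
  exact continuous_const.matrix_mul
    ((hU.matrix_mul (hF.comp continuous_fst)).matrix_mul hU.matrix_conjTranspose)

theorem continuous_eigSeq {X : Type*} [TopologicalSpace X] {F : X → Matrix n n ℂ}
    (hF : Continuous F) (hH : ∀ x, (F x).PosSemidef) (k : ℕ) :
    Continuous fun x => eigSeq (hH x).isHermitian k := by
  by_cases hk : k < Fintype.card n
  -- With these step weights the sum is that of the `m` largest eigenvalues; the `k`-th eigenvalue
  -- is the difference for `m = k + 1` and `m = k`.
  · have hanti : ∀ m : ℕ, Antitone fun l : ℕ => if l < m then (1 : ℝ) else 0 := by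
      intro m a b hab
      dsimp only
      split_ifs with h1 h2
      · exact le_rfl
      · exact absurd (hab.trans_lt h1) h2
      · exact zero_le_one
      · exact le_rfl
    have h := (continuous_sum_mul_eigSeq hF hH (hanti (k + 1))).sub
      (continuous_sum_mul_eigSeq hF hH (hanti k))
    refine h.congr fun x => ?_
    rw [Pi.sub_apply, ← Finset.sum_sub_distrib, Finset.sum_eq_single k]
    · simp
    · intro l _ hl
      have : l < k + 1 ↔ l < k := by omega
      simp [this]
    · intro h; exact absurd (Finset.mem_range.2 hk) h
  · simp only [eigSeq_of_le _ (not_lt.1 hk)]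
    exact continuous_const

end EigSeq

/-! ### Fourth-order moments of the Haar measure -/

theorem sum_integral_eq_of_pointwise {X κ ι : Type*} [MeasurableSpace X] {μ : Measure X}
    [Fintype κ] [Fintype ι] {f : κ → X → ℝ} {g : ι → X → ℝ} (hf : ∀ k, Integrable (f k) μ)
    (hg : ∀ k, Integrable (g k) μ) (c : ι → ℝ) (h : ∀ x, ∑ k, f k x = ∑ k, c k * g k x) :
    ∑ k, ∫ x, f k x ∂μ = ∑ k, c k * ∫ x, g k x ∂μ := by
  simp_rw [← integral_const_mul]
  rw [← integral_finsetSum _ fun k _ => hf k,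
    ← integral_finsetSum _ fun k _ => (hg k).const_mul (c k)]
  simp_rw [h]

/-- Double transitivity of the symmetric group: moments indexed by two distinct rows do not depend
on which rows these are. -/
theorem exists_perm_pair {n : Type*} [DecidableEq n] {a c a' c' : n} (h : a ≠ c) (h' : a' ≠ c') :
    ∃ σ : Equiv.Perm n, σ a = a' ∧ σ c = c' := by
  refine ⟨Equiv.swap (Equiv.swap a a' c) c' * Equiv.swap a a', ?_, by simp⟩
  have : a' ≠ Equiv.swap a a' c := by
    intro h2
    have := congrArg (Equiv.swap a a') h2
    simp at this
    exact h this
  simp [Equiv.swap_apply_of_ne_of_ne this h']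

section HaarMoments

variable {n : Type*} [Fintype n] [DecidableEq n]

theorem integral_haarUnitary_mul_left (W : Matrix.unitaryGroup n ℂ)
    (f : Matrix.unitaryGroup n ℂ → ℝ) :
    ∫ U, f (W * U) ∂(haarUnitary n) = ∫ U, f U ∂(haarUnitary n) := by
  have : (haarUnitary n).IsMulLeftInvariant := by unfold haarUnitary; infer_instance
  exact integral_mul_left_eq_self f W

theorem integrable_haarUnitary {f : Matrix.unitaryGroup n ℂ → ℝ} (hf : Continuous f) :
    Integrable f (haarUnitary n) :=
  hf.integrable_of_hasCompactSupport (HasCompactSupport.of_compactSpace f)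

theorem exists_unitary_perm (σ : Equiv.Perm n) : ∃ W : Matrix.unitaryGroup n ℂ,
    ∀ (U : Matrix.unitaryGroup n ℂ) a i,
      ((W * U : Matrix.unitaryGroup n ℂ) : Matrix n n ℂ) a i = (U : Matrix n n ℂ) (σ a) i := by
  have hW : σ.permMatrix ℂ ∈ Matrix.unitaryGroup n ℂ := by
    rw [Matrix.mem_unitaryGroup_iff, Equiv.Perm.permMatrix, PEquiv.toMatrix_toPEquiv_mul]
    ext a b
    simp [Matrix.star_apply, PEquiv.toMatrix_apply, Matrix.one_apply, eq_comm]
  refine ⟨⟨_, hW⟩, fun U a i => ?_⟩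
  change (σ.permMatrix ℂ * (U : Matrix n n ℂ)) a i = _
  rw [Equiv.Perm.permMatrix, PEquiv.toMatrix_toPEquiv_mul]
  rfl

/-- The reflection along a vector `w` as a unitary matrix, through its action on columns. -/
theorem exists_unitary_reflection (w : n → ℂ) {s : ℝ} (hs : s ≠ 0)
    (hw : ∑ a, Complex.normSq (w a) = s) : ∃ W : Matrix.unitaryGroup n ℂ,
    ∀ (U : Matrix.unitaryGroup n ℂ) a i,
      ((W * U : Matrix.unitaryGroup n ℂ) : Matrix n n ℂ) a i =
        (U : Matrix n n ℂ) a i - 2 / (s : ℂ) * w a * ∑ b, star (w b) * (U : Matrix n n ℂ) b i := by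
  have hs' : (s : ℂ) ≠ 0 := Complex.ofReal_ne_zero.2 hs
  have hdot : star w ⬝ᵥ w = (s : ℂ) := by
    rw [← hw, Complex.ofReal_sum]
    refine Finset.sum_congr rfl fun a _ => ?_
    rw [← Complex.mul_conj, mul_comm]
    rfl
  have hW : (1 - (2 / (s : ℂ)) • Matrix.vecMulVec w (star w) : Matrix n n ℂ) ∈
      Matrix.unitaryGroup n ℂ := by
    rw [Matrix.mem_unitaryGroup_iff, Matrix.star_eq_conjTranspose, Matrix.conjTranspose_sub,
      Matrix.conjTranspose_one, Matrix.conjTranspose_smul, Matrix.conjTranspose_vecMulVec]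
    have h2 : star (2 / (s : ℂ)) = 2 / (s : ℂ) := by simp
    rw [h2, star_star, mul_sub, sub_mul, sub_mul, mul_one, one_mul, mul_one, Matrix.smul_mul,
      Matrix.mul_smul, Matrix.vecMulVec_mul_vecMulVec, hdot, Matrix.vecMulVec_smul, smul_smul,
      smul_smul]
    have : 2 / (s : ℂ) * (2 / (s : ℂ)) * s = 2 / (s : ℂ) + 2 / (s : ℂ) := by
      field_simp; ring
    rw [this, add_smul]
    abel
  refine ⟨⟨_, hW⟩, fun U a i => ?_⟩
  change ((1 - (2 / (s : ℂ)) • Matrix.vecMulVec w (star w)) * (U : Matrix n n ℂ)) a i = _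
  rw [sub_mul, one_mul, Matrix.sub_apply, Matrix.smul_mul, Matrix.smul_apply, Matrix.mul_apply,
    smul_eq_mul, mul_assoc]
  congr 2
  rw [Finset.mul_sum]
  refine Finset.sum_congr rfl fun b _ => ?_
  rw [Matrix.vecMulVec_apply, Pi.star_apply]
  ring

theorem exists_unitary_neg (p : n) : ∃ W : Matrix.unitaryGroup n ℂ,
    ∀ (U : Matrix.unitaryGroup n ℂ) a i,
      ((W * U : Matrix.unitaryGroup n ℂ) : Matrix n n ℂ) a i =
        if a = p then -(U : Matrix n n ℂ) a i else (U : Matrix n n ℂ) a i := by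
  obtain ⟨W, hW⟩ := exists_unitary_reflection (Pi.single p (1 : ℂ)) one_ne_zero (by
    rw [Finset.sum_eq_single p] <;> simp +contextual)
  refine ⟨W, fun U a i => ?_⟩
  rw [hW, Finset.sum_eq_single p]
  · split_ifs with h
    · subst h; simp; ring
    · simp [h]
  · intro b _ hb; simp [hb]
  · simp

/-- The reflection along `e_p + 2 ω̄ e_q`, of squared norm 5. The coefficients 3/5 and 4/5 come from
`1 - 2/5` and `2 · 2/5`; the phase `ω` is left free for averaging. -/
theorem exists_unitary_mix {p q : n} (hpq : p ≠ q) {ω : ℂ} (hω : Complex.normSq ω = 1) :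
    ∃ W : Matrix.unitaryGroup n ℂ, ∀ (U : Matrix.unitaryGroup n ℂ) i,
      ((W * U : Matrix.unitaryGroup n ℂ) : Matrix n n ℂ) p i =
        (3 * (U : Matrix n n ℂ) p i - 4 * ω * (U : Matrix n n ℂ) q i) / 5 := by
  have hsum : ∀ f : n → ℂ → ℂ, (∀ b, f b 0 = 0) →
      ∑ b, f b ((Pi.single p 1 + Pi.single q (2 * star ω) : n → ℂ) b) =
        f p 1 + f q (2 * star ω) := by
    intro f hf
    rw [← Finset.sum_subset (Finset.subset_univ {p, q}), Finset.sum_pair hpq]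
    · simp [hpq, hpq.symm]
    · intro b _ hb
      simp only [Finset.mem_insert, Finset.mem_singleton, not_or] at hb
      simp [hb.1, hb.2, hf]
  obtain ⟨W, hW⟩ := exists_unitary_reflection
    (Pi.single p 1 + Pi.single q (2 * star ω) : n → ℂ) (s := 5) (by norm_num) (by
      have h := hsum (fun _ z => (Complex.normSq z : ℂ)) (by simp)
      rw [← Complex.ofReal_sum] at h
      have h' := congrArg Complex.re h
      simp [hω] at h'
      simp
      linarith)
  refine ⟨W, fun U i => ?_⟩
  rw [hW, hsum (fun b z => star z * (U : Matrix n n ℂ) b i) (by simp)]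
  simp [hpq]
  ring

/-- The real parts of the fourth-order moments of two columns of a Haar-random unitary. -/
noncomputable def haarMoment (i j a b c d : n) : ℝ :=
  ∫ U : Matrix.unitaryGroup n ℂ, ((U : Matrix n n ℂ) a i * star ((U : Matrix n n ℂ) b j) *
    (U : Matrix n n ℂ) c j * star ((U : Matrix n n ℂ) d i)).re ∂(haarUnitary n)

theorem continuous_haarMoment_integrand (i j a b c d : n) :
    Continuous fun U : Matrix.unitaryGroup n ℂ => ((U : Matrix n n ℂ) a i *
      star ((U : Matrix n n ℂ) b j) * (U : Matrix n n ℂ) c j *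
        star ((U : Matrix n n ℂ) d i)).re := by
  have h : ∀ a i, Continuous fun U : Matrix.unitaryGroup n ℂ => (U : Matrix n n ℂ) a i :=
    fun a i => continuous_subtype_val.matrix_elem a i
  exact Complex.continuous_re.comp
    ((((h a i).mul (h b j).star).mul (h c j)).mul (h d i).star)

theorem haarMoment_perm (σ : Equiv.Perm n) (i j a b c d : n) :
    haarMoment i j (σ a) (σ b) (σ c) (σ d) = haarMoment i j a b c d := by
  obtain ⟨W, hW⟩ := exists_unitary_perm σ
  conv_rhs => rw [haarMoment, ← integral_haarUnitary_mul_left W]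
  simp_rw [hW]
  rfl

/-- Row `a` enters exactly once, so flipping its sign negates the integrand. -/
theorem haarMoment_eq_zero {i j a b c d : n} (hb : b ≠ a) (hc : c ≠ a) (hd : d ≠ a) :
    haarMoment i j a b c d = 0 := by
  obtain ⟨W, hW⟩ := exists_unitary_neg a
  have h : haarMoment i j a b c d = - haarMoment i j a b c d := by
    conv_lhs => rw [haarMoment, ← integral_haarUnitary_mul_left W]
    simp_rw [hW, if_true, if_neg hb, if_neg hc, if_neg hd]
    rw [haarMoment, ← integral_neg]
    simp only [neg_mul, Complex.neg_re]
  linarith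

/-- Invariance under the mixing reflection, averaged over the phase. The coefficients are `5⁴`,
`3⁴`, `4⁴` and `3² · 4²`. Once the moments are identified by symmetry, this says that the diagonal
moment is the sum of the cross and the exchange moment. -/
theorem haarMoment_mix (i j : n) {a c : n} (hac : a ≠ c) :
    625 * haarMoment i j a a a a = 81 * haarMoment i j a a a a + 256 * haarMoment i j c c c c +
      144 * (haarMoment i j a c c a + haarMoment i j c a a c) +
      144 * (haarMoment i j a a c c + haarMoment i j c c a a) := by
  have hrot : ∀ ω : ℂ, Complex.normSq ω = 1 → haarMoment i j a a a a =
      ∫ U : Matrix.unitaryGroup n ℂ, Complex.normSq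
        (3 * (U : Matrix n n ℂ) a i - 4 * ω * (U : Matrix n n ℂ) c i) * Complex.normSq
        (3 * (U : Matrix n n ℂ) a j - 4 * ω * (U : Matrix n n ℂ) c j) / 625 ∂(haarUnitary n) := by
    intro ω hω
    obtain ⟨W, hW⟩ := exists_unitary_mix hac hω
    rw [haarMoment, ← integral_haarUnitary_mul_left W]
    refine integral_congr_ae (Filter.Eventually.of_forall fun U => ?_)
    simp_rw [hW]
    have : ∀ x y : ℂ, (x / 5 * star (y / 5) * (y / 5) * star (x / 5)).re =
        Complex.normSq x * Complex.normSq y / 625 := by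
      intro x y
      simp [Complex.normSq_apply]
      ring
    exact this _ _
  have hcont : ∀ ω : ℂ, Integrable (fun U : Matrix.unitaryGroup n ℂ => Complex.normSq
        (3 * (U : Matrix n n ℂ) a i - 4 * ω * (U : Matrix n n ℂ) c i) * Complex.normSq
        (3 * (U : Matrix n n ℂ) a j - 4 * ω * (U : Matrix n n ℂ) c j) / 625)
        (haarUnitary n) := by
    intro ω
    have h : ∀ a i, Continuous fun U : Matrix.unitaryGroup n ℂ => (U : Matrix n n ℂ) a i :=
      fun a i => continuous_subtype_val.matrix_elem a i
    refine integrable_haarUnitary (((Complex.continuous_normSq.comp ?_).mul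
      (Complex.continuous_normSq.comp ?_)).div_const _)
    · exact (continuous_const.mul (h a i)).sub (continuous_const.mul (h c i))
    · exact (continuous_const.mul (h a j)).sub (continuous_const.mul (h c j))
  have hint := fun p q r s : n => integrable_haarUnitary
    (continuous_haarMoment_integrand i j p q r s)
  have h4 : haarMoment i j a a a a + haarMoment i j a a a a + haarMoment i j a a a a +
      haarMoment i j a a a a = 4 / 625 * (81 * haarMoment i j a a a a +
      256 * haarMoment i j c c c c + 144 * (haarMoment i j a c c a + haarMoment i j c a a c) +
      144 * (haarMoment i j a a c c + haarMoment i j c c a a)) := by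
    -- Summing over the fourth roots of unity kills the terms in `ω`, `ω²` and their conjugates; the
    -- signs `±1` alone would keep `ω²`. The six balanced terms remain, each counted four times.
    have h := sum_integral_eq_of_pointwise (fun k : Fin 4 =>
      hcont ((![1, -1, Complex.I, -Complex.I] : Fin 4 → ℂ) k)) (fun k : Fin 6 =>
      hint ((![a, c, a, c, a, c] : Fin 6 → n) k) ((![a, c, c, a, a, c] : Fin 6 → n) k)
        ((![a, c, c, a, c, a] : Fin 6 → n) k) ((![a, c, a, c, c, a] : Fin 6 → n) k))
      (fun k => 4 / 625 * (![81, 256, 144, 144, 144, 144] : Fin 6 → ℝ) k) ?_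
    · simp only [Fin.sum_univ_succ, Fin.sum_univ_zero] at h
      simp only [Matrix.cons_val_zero, Matrix.cons_val_succ] at h
      rw [← hrot 1 (by simp), ← hrot (-1) (by simp), ← hrot Complex.I (by simp),
        ← hrot (-Complex.I) (by simp)] at h
      simp only [haarMoment] at h ⊢
      linarith
    · intro U
      simp only [Fin.sum_univ_succ, Fin.sum_univ_zero, Matrix.cons_val_zero, Matrix.cons_val_succ]
      simp [Complex.normSq_apply]
      ring
  linarith

/-- Moments of the form `E |x_a|² |y_c|²` with `a ≠ c`. -/
noncomputable def crossMoment (δ N : ℝ) : ℝ := (N - δ) / (N * (N ^ 2 - 1))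

/-- Moments of the form `E x_a y̅_a y_c x̅_c` with `a ≠ c`. -/
noncomputable def exchangeMoment (δ N : ℝ) : ℝ := (δ * N - 1) / (N * (N ^ 2 - 1))

/-- Pointwise, the sum is the product of the squared norms of columns `i` and `j`. -/
theorem sum_haarMoment_cross (i j : n) : ∑ a, ∑ c, haarMoment i j a c c a = 1 := by
  have hint := fun p q r s : n => integrable_haarUnitary
    (continuous_haarMoment_integrand i j p q r s)
  simp only [haarMoment]
  simp_rw [← integral_finsetSum _ fun c _ => hint _ c c _]
  rw [← integral_finsetSum _ fun a _ => integrable_finsetSum _ fun c _ => hint a c c a]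
  have hpt : ∀ U : Matrix.unitaryGroup n ℂ, ∑ a, ∑ c, ((U : Matrix n n ℂ) a i *
      star ((U : Matrix n n ℂ) c j) * (U : Matrix n n ℂ) c j *
        star ((U : Matrix n n ℂ) a i)).re = 1 := by
    intro U
    have h := fun k => congrFun (congrFun (Matrix.mem_unitaryGroup_iff'.1 U.2) k) k
    simp only [Matrix.mul_apply, Matrix.one_apply_eq, Matrix.star_apply] at h
    have h2 : (∑ a, ∑ c, ((U : Matrix n n ℂ) a i * star ((U : Matrix n n ℂ) c j) *
        (U : Matrix n n ℂ) c j * star ((U : Matrix n n ℂ) a i))) = 1 := by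
      have h1 : (1 : ℂ) = (∑ a, star ((U : Matrix n n ℂ) a i) * (U : Matrix n n ℂ) a i) *
          ∑ c, star ((U : Matrix n n ℂ) c j) * (U : Matrix n n ℂ) c j := by
        rw [h i, h j, one_mul]
      rw [h1, Finset.sum_mul_sum]
      exact Finset.sum_congr rfl fun a _ => Finset.sum_congr rfl fun c _ => by ring
    simpa using congrArg Complex.re h2
  simp_rw [hpt]
  simp

/-- Pointwise, the sum is the squared modulus of the inner product of columns `i` and `j`. -/
theorem sum_haarMoment_exchange (i j : n) :
    ∑ a, ∑ c, haarMoment i j a a c c = if i = j then 1 else 0 := by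
  have hint := fun p q r s : n => integrable_haarUnitary
    (continuous_haarMoment_integrand i j p q r s)
  simp only [haarMoment]
  simp_rw [← integral_finsetSum _ fun c _ => hint _ _ c c]
  rw [← integral_finsetSum _ fun a _ => integrable_finsetSum _ fun c _ => hint a a c c]
  have hpt : ∀ U : Matrix.unitaryGroup n ℂ, ∑ a, ∑ c, ((U : Matrix n n ℂ) a i *
      star ((U : Matrix n n ℂ) a j) * (U : Matrix n n ℂ) c j *
        star ((U : Matrix n n ℂ) c i)).re = if i = j then 1 else 0 := by
    intro U
    have h := fun k l => congrFun (congrFun (Matrix.mem_unitaryGroup_iff'.1 U.2) k) l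
    simp only [Matrix.mul_apply, Matrix.one_apply, Matrix.star_apply] at h
    have h2 : (∑ a, ∑ c, ((U : Matrix n n ℂ) a i * star ((U : Matrix n n ℂ) a j) *
        (U : Matrix n n ℂ) c j * star ((U : Matrix n n ℂ) c i))) =
        (if j = i then 1 else 0) * (if i = j then 1 else 0) := by
      rw [← h i j, ← h j i, Finset.sum_mul_sum]
      exact Finset.sum_congr rfl fun a _ => Finset.sum_congr rfl fun c _ => by ring
    have h3 := congrArg Complex.re h2
    rw [Complex.re_sum] at h3
    simp_rw [Complex.re_sum] at h3
    rw [h3]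
    by_cases hij : i = j <;> simp [hij]
  simp_rw [hpt]
  simp

theorem haarMoment_values (i j : n) (hn : 2 ≤ Fintype.card n) :
    (∀ a c, a ≠ c → haarMoment i j a c c a =
      crossMoment (if i = j then 1 else 0) (Fintype.card n)) ∧
    (∀ a c, a ≠ c → haarMoment i j a a c c =
      exchangeMoment (if i = j then 1 else 0) (Fintype.card n)) ∧
    ∀ a, haarMoment i j a a a a = crossMoment (if i = j then 1 else 0) (Fintype.card n) +
      exchangeMoment (if i = j then 1 else 0) (Fintype.card n) := by
  obtain ⟨p, q, hpq⟩ := Fintype.one_lt_card_iff.1 hn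
  have hα : ∀ a, haarMoment i j a a a a = haarMoment i j p p p p := by
    intro a
    simpa using haarMoment_perm (Equiv.swap p a) i j p p p p
  have hβ : ∀ a c, a ≠ c → haarMoment i j a c c a = haarMoment i j p q q p := by
    intro a c hac
    obtain ⟨σ, rfl, rfl⟩ := exists_perm_pair hpq hac
    exact haarMoment_perm σ i j p q q p
  have hγ : ∀ a c, a ≠ c → haarMoment i j a a c c = haarMoment i j p p q q := by
    intro a c hac
    obtain ⟨σ, rfl, rfl⟩ := exists_perm_pair hpq hac
    exact haarMoment_perm σ i j p p q q
  have hsum : ∀ x y : ℝ, ∑ a : n, ∑ c : n, (if a = c then x else y) =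
      Fintype.card n * x + Fintype.card n * (Fintype.card n - 1) * y := by
    intro x y
    have : ∀ a c : n, (if a = c then x else y) = (if a = c then x - y else 0) + y := by
      intro a c; split_ifs <;> ring
    simp_rw [this, Finset.sum_add_distrib]
    simp
    ring
  have h1 := haarMoment_mix i j hpq
  rw [hα q, hβ q p hpq.symm, hγ q p hpq.symm] at h1
  have h2 := sum_haarMoment_cross i j
  have h3 := sum_haarMoment_exchange i j
  have e2 : ∀ a c, haarMoment i j a c c a =
      if a = c then haarMoment i j p p p p else haarMoment i j p q q p := by
    intro a c
    split_ifs with h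
    · subst h; exact hα a
    · exact hβ a c h
  have e3 : ∀ a c, haarMoment i j a a c c =
      if a = c then haarMoment i j p p p p else haarMoment i j p p q q := by
    intro a c
    split_ifs with h
    · subst h; exact hα a
    · exact hγ a c h
  rw [Finset.sum_congr rfl fun a _ => Finset.sum_congr rfl fun c _ => e2 a c, hsum] at h2
  rw [Finset.sum_congr rfl fun a _ => Finset.sum_congr rfl fun c _ => e3 a c, hsum] at h3
  generalize haarMoment i j p p p p = α at *
  generalize haarMoment i j p q q p = β at *
  generalize haarMoment i j p p q q = γ at *
  generalize (if i = j then (1 : ℝ) else 0) = δ at *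
  have hN : (2 : ℝ) ≤ Fintype.card n := by exact_mod_cast hn
  generalize (Fintype.card n : ℝ) = N at *
  have hN0 : N ≠ 0 := by linarith
  have hN1 : N - 1 ≠ 0 := by linarith
  have hN2 : N + 1 ≠ 0 := by linarith
  have hN3 : N ^ 2 - 1 ≠ 0 := by
    rw [show N ^ 2 - 1 = (N - 1) * (N + 1) by ring]; exact mul_ne_zero hN1 hN2
  have hD : N * (N ^ 2 - 1) ≠ 0 := mul_ne_zero hN0 hN3
  -- With this, `h2` and `h3` become `N² β + N γ = 1` and `N β + N² γ = δ`, a system with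
  -- determinant `N² (N² - 1)`.
  have hαeq : α = β + γ := by linarith
  have hβeq : β = crossMoment δ N := by
    rw [crossMoment, eq_div_iff hD]
    linear_combination N * h2 - h3 - N * (N - 1) * hαeq
  have hγeq : γ = exchangeMoment δ N := by
    rw [exchangeMoment, eq_div_iff hD]
    linear_combination N * h3 - h2 - N * (N - 1) * hαeq
  exact ⟨fun a c h => (hβ a c h).trans hβeq, fun a c h => (hγ a c h).trans hγeq, fun a => by
    rw [hα, hαeq, hβeq, hγeq]⟩

end HaarMoments

/-! ### The error for a fixed isometry -/

section Purifications

variable {dI dO dE : ℕ}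

/-- The Choi vector of `V` as a matrix from the environment to `H_I ⊗ H_O`. -/
def choiMat (V : Matrix (Fin dO × Fin dE) (Fin dI) ℂ) :
    Matrix (Fin dI × Fin dO) (Fin dE) ℂ :=
  Matrix.of fun p e => choiVec V (p, e)

/-- The operator induced on the environment by the Choi vector (up to a transposition, the partial
trace of `|V⟩⟨V|` over `H_I ⊗ H_O`). -/
def envOp (V : Matrix (Fin dO × Fin dE) (Fin dI) ℂ) : Matrix (Fin dE) (Fin dE) ℂ :=
  (choiMat V)ᵀ * ((choiMat V)ᵀ)ᴴ

theorem choiOp_eq_mul (V : Matrix (Fin dO × Fin dE) (Fin dI) ℂ) :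
    choiOp V = choiMat V * (choiMat V)ᴴ := by
  ext p q
  simp [choiOp, partialTraceRight, choiProj, Matrix.vecMulVec_apply, Matrix.mul_apply, choiMat]

theorem choiOp_posSemidef (V : Matrix (Fin dO × Fin dE) (Fin dI) ℂ) : (choiOp V).PosSemidef := by
  rw [choiOp_eq_mul]
  exact Matrix.posSemidef_self_mul_conjTranspose _

theorem envOp_posSemidef (V : Matrix (Fin dO × Fin dE) (Fin dI) ℂ) : (envOp V).PosSemidef :=
  Matrix.posSemidef_self_mul_conjTranspose _

/-- The ordered eigenvalues of the Choi operator, continued by zeros. -/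
noncomputable def choiEig (V : Matrix (Fin dO × Fin dE) (Fin dI) ℂ) : ℕ → ℝ :=
  eigSeq (choiOp_isHermitian V)

/-- `M Mᴴ` and `Mᴴ M` have the same characteristic polynomial up to powers of `X`, and transposition
does not change it. In particular at most `d_E` eigenvalues of `C` are non-zero. -/
theorem choiEig_eq_env (V : Matrix (Fin dO × Fin dE) (Fin dI) ℂ) :
    choiEig V = eigSeq (envOp_posSemidef V).isHermitian := by
  have h := Matrix.charpoly_mul_comm' (choiMat V)ᵀ ((choiMat V)ᵀ)ᴴ
  have h' : ((choiMat V)ᵀ)ᴴ * (choiMat V)ᵀ = (choiOp V)ᵀ := by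
    rw [choiOp_eq_mul, Matrix.transpose_mul]
    rfl
  rw [h', Matrix.charpoly_transpose] at h
  exact (eigSeq_eq_of_charpoly (envOp_posSemidef V) (choiOp_posSemidef V) h).symm

theorem choiEig_eq_zero_of_env_le (V : Matrix (Fin dO × Fin dE) (Fin dI) ℂ) {k : ℕ}
    (hk : dE ≤ k) : choiEig V k = 0 := by
  rw [choiEig_eq_env]
  exact eigSeq_of_le _ (by simpa using hk)

theorem choiEig_eq_zero_of_le (V : Matrix (Fin dO × Fin dE) (Fin dI) ℂ) {k : ℕ}
    (hk : Fintype.card (Fin dI × Fin dO) ≤ k) : choiEig V k = 0 :=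
  eigSeq_of_le _ hk

theorem choiEig_nonneg (V : Matrix (Fin dO × Fin dE) (Fin dI) ℂ) (k : ℕ) : 0 ≤ choiEig V k :=
  eigSeq_nonneg (choiOp_posSemidef V) k

theorem choiEig_sq_antitone (V : Matrix (Fin dO × Fin dE) (Fin dI) ℂ) :
    Antitone fun k => choiEig V k ^ 2 := fun _ _ hkl =>
  pow_le_pow_left₀ (choiEig_nonneg V _) (eigSeq_antitone (choiOp_posSemidef V) hkl) 2

theorem orderedEig_eq (V : Matrix (Fin dO × Fin dE) (Fin dI) ℂ)
    (i : Fin (Fintype.card (Fin dI × Fin dO))) : orderedEig V i = choiEig V i :=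
  (eigSeq_fin _ i).symm

theorem sum_range_congr_of_eventually_zero {f : ℕ → ℝ} {m n : ℕ} (hm : ∀ k, m ≤ k → f k = 0)
    (hn : ∀ k, n ≤ k → f k = 0) : ∑ k ∈ Finset.range m, f k = ∑ k ∈ Finset.range n, f k := by
  have h : ∀ l, (∀ k, l ≤ k → f k = 0) → l ≤ max m n →
      ∑ k ∈ Finset.range l, f k = ∑ k ∈ Finset.range (max m n), f k := by
    intro l hl hle
    refine Finset.sum_subset (Finset.range_subset_range.2 hle) fun k _ hk => hl k ?_
    simpa using hk
  rw [h m hm (le_max_left _ _), h n hn (le_max_right _ _)]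

theorem conj_diagonal_mul_self {n : Type*} [Fintype n] [DecidableEq n]
    (P : Matrix.unitaryGroup n ℂ) (a : n → ℝ) {A : Matrix n n ℂ}
    (hA : A = (P : Matrix n n ℂ) * Matrix.diagonal (fun i => (a i : ℂ)) * (P : Matrix n n ℂ)ᴴ) :
    A * A = (P : Matrix n n ℂ) * Matrix.diagonal (fun i => ((a i ^ 2 : ℝ) : ℂ)) *
      (P : Matrix n n ℂ)ᴴ := by
  have hP : (P : Matrix n n ℂ)ᴴ * (P : Matrix n n ℂ) = 1 := Matrix.mem_unitaryGroup_iff'.1 P.2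
  rw [hA]
  calc _ = (P : Matrix n n ℂ) * Matrix.diagonal (fun i => (a i : ℂ)) *
        ((P : Matrix n n ℂ)ᴴ * (P : Matrix n n ℂ)) * Matrix.diagonal (fun i => (a i : ℂ)) *
        (P : Matrix n n ℂ)ᴴ := by simp only [Matrix.mul_assoc]
    _ = _ := by
      rw [hP, Matrix.mul_one, Matrix.mul_assoc (P : Matrix n n ℂ), Matrix.diagonal_mul_diagonal]
      simp only [pow_two, Complex.ofReal_mul]

theorem re_trace_conj_diagonal {n : Type*} [Fintype n] [DecidableEq n]
    (P : Matrix.unitaryGroup n ℂ) (a : n → ℝ) :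
    (Matrix.trace ((P : Matrix n n ℂ) * Matrix.diagonal (fun i => (a i : ℂ)) *
      (P : Matrix n n ℂ)ᴴ)).re = ∑ i, a i := by
  have hP : (P : Matrix n n ℂ)ᴴ * (P : Matrix n n ℂ) = 1 := Matrix.mem_unitaryGroup_iff'.1 P.2
  rw [Matrix.mul_assoc, Matrix.trace_mul_comm, Matrix.mul_assoc, hP, Matrix.mul_one,
    Matrix.trace_diagonal, Complex.re_sum]
  simp

theorem purity_eq_sum (V : Matrix (Fin dO × Fin dE) (Fin dI) ℂ) :
    purity V = ∑ k ∈ Finset.range dE, choiEig V k ^ 2 := by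
  obtain ⟨P, hP⟩ := exists_unitary_diagonalization (choiOp_isHermitian V)
  rw [purity, conj_diagonal_mul_self P _ hP, re_trace_conj_diagonal,
    sum_eigIndex (fun k => eigSeq (choiOp_isHermitian V) k ^ 2)]
  refine sum_range_congr_of_eventually_zero (f := fun k => choiEig V k ^ 2) ?_ ?_
  · intro k hk; simp [choiEig_eq_zero_of_le V hk]
  · intro k hk; simp [choiEig_eq_zero_of_env_le V hk]

/-- The squared norm of the Choi vector. -/
noncomputable def choiNormSq (V : Matrix (Fin dO × Fin dE) (Fin dI) ℂ) : ℝ :=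
  (star (choiVec V) ⬝ᵥ choiVec V).re

theorem im_dotProduct_star_self {α : Type*} [Fintype α] (w : α → ℂ) : (star w ⬝ᵥ w).im = 0 := by
  rw [dotProduct, Complex.im_sum]
  refine Finset.sum_eq_zero fun x _ => ?_
  simp
  ring

theorem hsNormSq_sub_vecMulVec {α : Type*} [Fintype α] {A : Matrix α α ℂ} (hA : A.IsHermitian)
    (w : α → ℂ) : hsNormSq (A - Matrix.vecMulVec w (star w)) =
      (Matrix.trace (A * A)).re - 2 * (star w ⬝ᵥ A *ᵥ w).re + (star w ⬝ᵥ w).re ^ 2 := by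
  have h1 : Matrix.trace (A * Matrix.vecMulVec w (star w)) = star w ⬝ᵥ A *ᵥ w := by
    rw [Matrix.mul_vecMulVec, Matrix.trace_vecMulVec, dotProduct_comm]
  have h2 : Matrix.trace (Matrix.vecMulVec w (star w) * Matrix.vecMulVec w (star w)) =
      (star w ⬝ᵥ w) * (star w ⬝ᵥ w) := by
    rw [Matrix.mul_vecMulVec, Matrix.trace_vecMulVec, dotProduct_comm, Matrix.vecMulVec_mulVec]
    simp
  rw [hsNormSq, Matrix.conjTranspose_sub, hA.eq, Matrix.conjTranspose_vecMulVec, star_star,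
    sub_mul, mul_sub, mul_sub, Matrix.trace_sub, Matrix.trace_sub, Matrix.trace_sub,
    Matrix.trace_mul_comm (Matrix.vecMulVec w (star w)) A, h1, h2]
  simp only [Complex.sub_re, Complex.mul_re, im_dotProduct_star_self]
  ring

theorem im_trace_mul_self {α : Type*} [Fintype α] {A : Matrix α α ℂ} (hA : A.IsHermitian) :
    (Matrix.trace (A * A)).im = 0 := by
  have h : star (Matrix.trace (A * A)) = Matrix.trace (A * A) := by
    rw [← Matrix.trace_conjTranspose, Matrix.conjTranspose_mul, hA.eq]
  exact Complex.conj_eq_iff_im.1 h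

theorem dotProduct_kronecker_mulVec {α β : Type*} [Fintype α] [Fintype β] (M : Matrix α β ℂ)
    (C : Matrix α α ℂ) (σ : Matrix β β ℂ) :
    star (fun x : α × β => M x.1 x.2) ⬝ᵥ (C ⊗ₖ σ) *ᵥ (fun x : α × β => M x.1 x.2) =
      Matrix.trace (σ * (Mᵀ * Cᵀ * (Mᵀ)ᴴ)) := by
  simp only [Matrix.trace, dotProduct, Matrix.mulVec, Fintype.sum_prod_type, Matrix.diag_apply,
    Matrix.mul_apply, Matrix.kroneckerMap_apply, Matrix.transpose_apply, Pi.star_apply,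
    Matrix.conjTranspose_apply, Finset.mul_sum, Finset.sum_mul]
  rw [Finset.sum_comm]
  refine Finset.sum_congr rfl fun e _ => ?_
  rw [Finset.sum_congr rfl fun p _ => Finset.sum_comm, Finset.sum_comm]
  refine Finset.sum_congr rfl fun f _ => ?_
  refine Finset.sum_congr rfl fun p _ => Finset.sum_congr rfl fun q _ => ?_
  ring

/-- The overlap of the output with the purification lives on the environment only, since `Mᵀ (M Mᴴ)ᵀ
(Mᵀ)ᴴ = (Mᵀ (Mᵀ)ᴴ)²`. -/
theorem dotProduct_choiOp_kronecker (V : Matrix (Fin dO × Fin dE) (Fin dI) ℂ)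
    (σ : Matrix (Fin dE) (Fin dE) ℂ) :
    star (choiVec V) ⬝ᵥ (choiOp V ⊗ₖ σ) *ᵥ choiVec V = Matrix.trace (σ * (envOp V * envOp V)) := by
  have h : envOp V * envOp V = (choiMat V)ᵀ * (choiOp V)ᵀ * ((choiMat V)ᵀ)ᴴ := by
    rw [choiOp_eq_mul, Matrix.transpose_mul, envOp]
    simp only [Matrix.mul_assoc]
    rfl
  rw [h]
  exact dotProduct_kronecker_mulVec (choiMat V) (choiOp V) σ

/-- The rotation moves from the Choi vector onto `ρ`; it preserves the norm of the vector, so only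
the overlap sees `U`. -/
theorem dist2_eq {ρ : Matrix (Fin dE) (Fin dE) ℂ} (hρ : ρ.IsHermitian)
    (V : Matrix (Fin dO × Fin dE) (Fin dI) ℂ) (U : Matrix.unitaryGroup (Fin dE) ℂ) :
    dist2 ρ V U = purity V * (Matrix.trace (ρ * ρ)).re + choiNormSq V ^ 2 -
      2 * (Matrix.trace (ρ * ((U : Matrix (Fin dE) (Fin dE) ℂ) * (envOp V * envOp V) *
        (U : Matrix (Fin dE) (Fin dE) ℂ)ᴴ))).re := by
  set K : Matrix ((Fin dI × Fin dO) × Fin dE) ((Fin dI × Fin dO) × Fin dE) ℂ :=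
    (1 : Matrix (Fin dI × Fin dO) (Fin dI × Fin dO) ℂ) ⊗ₖ (U : Matrix (Fin dE) (Fin dE) ℂ) with hK
  have hU : (U : Matrix (Fin dE) (Fin dE) ℂ)ᴴ * (U : Matrix (Fin dE) (Fin dE) ℂ) = 1 :=
    Matrix.mem_unitaryGroup_iff'.1 U.2
  have hKH : Kᴴ = (1 : Matrix (Fin dI × Fin dO) (Fin dI × Fin dO) ℂ) ⊗ₖ
      (U : Matrix (Fin dE) (Fin dE) ℂ)ᴴ := by
    rw [hK, Matrix.conjTranspose_kronecker, Matrix.conjTranspose_one]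
  have hrot : rotatedProj V U =
      Matrix.vecMulVec (K *ᵥ choiVec V) (star (K *ᵥ choiVec V)) := by
    rw [rotatedProj, choiProj, Matrix.mul_vecMulVec, Matrix.vecMulVec_mul, Matrix.star_mulVec]
  have hform : ∀ A, star (K *ᵥ choiVec V) ⬝ᵥ A *ᵥ (K *ᵥ choiVec V) =
      star (choiVec V) ⬝ᵥ (Kᴴ * A * K) *ᵥ choiVec V := by
    intro A
    rw [Matrix.star_mulVec, ← Matrix.dotProduct_mulVec, Matrix.mulVec_mulVec, Matrix.mulVec_mulVec,
      Matrix.mul_assoc]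
  have hA : (choiOp V ⊗ₖ ρ).IsHermitian := by
    rw [Matrix.IsHermitian, Matrix.conjTranspose_kronecker, hρ.eq, (choiOp_isHermitian V).eq]
  have hnorm : star (K *ᵥ choiVec V) ⬝ᵥ (K *ᵥ choiVec V) = star (choiVec V) ⬝ᵥ choiVec V := by
    have h := hform 1
    rw [Matrix.one_mulVec, Matrix.mul_one, hKH, hK, ← Matrix.mul_kronecker_mul, hU,
      Matrix.one_mul, Matrix.one_kronecker_one, Matrix.one_mulVec] at h
    exact h
  have hcross : Kᴴ * (choiOp V ⊗ₖ ρ) * K = choiOp V ⊗ₖ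
      ((U : Matrix (Fin dE) (Fin dE) ℂ)ᴴ * ρ * (U : Matrix (Fin dE) (Fin dE) ℂ)) := by
    rw [hKH, hK, ← Matrix.mul_kronecker_mul, ← Matrix.mul_kronecker_mul, Matrix.one_mul,
      Matrix.mul_one]
  rw [dist2, appendEnv, hrot, hsNormSq_sub_vecMulVec hA, hnorm, hform, hcross,
    dotProduct_choiOp_kronecker, ← Matrix.mul_kronecker_mul, Matrix.trace_kronecker,
    Complex.mul_re, im_trace_mul_self hρ, purity, choiNormSq]
  have htr : Matrix.trace ((U : Matrix (Fin dE) (Fin dE) ℂ)ᴴ * ρ *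
      (U : Matrix (Fin dE) (Fin dE) ℂ) * (envOp V * envOp V)) =
      Matrix.trace (ρ * ((U : Matrix (Fin dE) (Fin dE) ℂ) * (envOp V * envOp V) *
        (U : Matrix (Fin dE) (Fin dE) ℂ)ᴴ)) := by
    rw [Matrix.mul_assoc, Matrix.mul_assoc, Matrix.trace_mul_comm]
    simp only [Matrix.mul_assoc]
  rw [htr]
  ring

theorem isLeast_dist2 {ρ : Matrix (Fin dE) (Fin dE) ℂ} (P : Matrix.unitaryGroup (Fin dE) ℂ)
    {a : ℕ → ℝ} (ha : Antitone a)
    (hρ : ρ = (P : Matrix (Fin dE) (Fin dE) ℂ) *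
      Matrix.diagonal (fun i => ((a (eigIndex i) : ℝ) : ℂ)) * (P : Matrix (Fin dE) (Fin dE) ℂ)ᴴ)
    (V : Matrix (Fin dO × Fin dE) (Fin dI) ℂ) :
    IsLeast (Set.range (dist2 ρ V)) (purity V * ∑ k ∈ Finset.range dE, a k ^ 2 +
      choiNormSq V ^ 2 - 2 * ∑ k ∈ Finset.range dE, a k * choiEig V k ^ 2) := by
  have hH : ρ.IsHermitian := by
    rw [hρ, Matrix.IsHermitian, Matrix.conjTranspose_mul, Matrix.conjTranspose_mul,
      Matrix.conjTranspose_conjTranspose, Matrix.diagonal_conjTranspose, Matrix.mul_assoc]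
    congr 3
    ext i
    simp
  obtain ⟨Q, hQ⟩ := exists_unitary_diagonalization (envOp_posSemidef V).isHermitian
  rw [← choiEig_eq_env] at hQ
  have hmono : Monovary (fun i : Fin dE => a (eigIndex i))
      (fun i : Fin dE => choiEig V (eigIndex i) ^ 2) :=
    (ha.monovary (choiEig_sq_antitone V)).comp_right eigIndex
  have hgr := isGreatest_re_trace_conj P Q hmono hρ (conj_diagonal_mul_self Q _ hQ)
  have hs := sum_eigIndex (n := Fin dE) (fun k => a k * choiEig V k ^ 2)
  have hs2 := sum_eigIndex (n := Fin dE) (fun k => a k ^ 2)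
  rw [Fintype.card_fin] at hs hs2
  have htr : (Matrix.trace (ρ * ρ)).re = ∑ k ∈ Finset.range dE, a k ^ 2 := by
    rw [conj_diagonal_mul_self P _ hρ, re_trace_conj_diagonal, hs2]
  rw [← hs, ← htr]
  constructor
  · obtain ⟨U, hU⟩ := hgr.1
    exact ⟨U, by rw [dist2_eq hH, ← hU]⟩
  · rintro _ ⟨U, rfl⟩
    rw [dist2_eq hH]
    have := hgr.2 ⟨U, rfl⟩
    dsimp only at this
    linarith

theorem bestDist2_eq {ρ : Matrix (Fin dE) (Fin dE) ℂ} (P : Matrix.unitaryGroup (Fin dE) ℂ)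
    {a : ℕ → ℝ} (ha : Antitone a)
    (hρ : ρ = (P : Matrix (Fin dE) (Fin dE) ℂ) *
      Matrix.diagonal (fun i => ((a (eigIndex i) : ℝ) : ℂ)) * (P : Matrix (Fin dE) (Fin dE) ℂ)ᴴ)
    (V : Matrix (Fin dO × Fin dE) (Fin dI) ℂ) :
    bestDist2 ρ V = purity V * ∑ k ∈ Finset.range dE, a k ^ 2 +
      choiNormSq V ^ 2 - 2 * ∑ k ∈ Finset.range dE, a k * choiEig V k ^ 2 :=
  (isLeast_dist2 P ha hρ V).csInf_eq

theorem exists_antitone_diagonalization {ρ : Matrix (Fin dE) (Fin dE) ℂ} (hρ : ρ.PosSemidef) :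
    ∃ (P : Matrix.unitaryGroup (Fin dE) ℂ) (a : ℕ → ℝ), Antitone a ∧
      ρ = (P : Matrix (Fin dE) (Fin dE) ℂ) *
        Matrix.diagonal (fun i => ((a (eigIndex i) : ℝ) : ℂ)) *
        (P : Matrix (Fin dE) (Fin dE) ℂ)ᴴ := by
  obtain ⟨P, hP⟩ := exists_unitary_diagonalization hρ.isHermitian
  exact ⟨P, _, eigSeq_antitone hρ, hP⟩

end Purifications

/-! ### Averaging over the isometry and optimizing the appended state -/

section Averages

variable {dI dO dE : ℕ}

theorem continuous_choiMat : Continuous (choiMat : Matrix (Fin dO × Fin dE) (Fin dI) ℂ → _) :=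
  continuous_matrix fun p e => continuous_id.matrix_elem (p.2, e) p.1

theorem continuous_choiOp : Continuous (choiOp : Matrix (Fin dO × Fin dE) (Fin dI) ℂ → _) := by
  simp_rw [funext choiOp_eq_mul]
  exact continuous_choiMat.matrix_mul continuous_choiMat.matrix_conjTranspose

theorem continuous_choiEig (k : ℕ) :
    Continuous fun V : Matrix (Fin dO × Fin dE) (Fin dI) ℂ => choiEig V k :=
  continuous_eigSeq continuous_choiOp choiOp_posSemidef k

theorem continuous_purity :
    Continuous (purity : Matrix (Fin dO × Fin dE) (Fin dI) ℂ → ℝ) :=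
  Complex.continuous_re.comp (continuous_choiOp.matrix_mul continuous_choiOp).matrix_trace

theorem continuous_choiNormSq :
    Continuous (choiNormSq : Matrix (Fin dO × Fin dE) (Fin dI) ℂ → ℝ) := by
  have h : Continuous (choiVec : Matrix (Fin dO × Fin dE) (Fin dI) ℂ → _) :=
    continuous_pi fun x => continuous_id.matrix_elem (x.1.2, x.2) x.1.1
  exact Complex.continuous_re.comp (h.star.dotProduct h)

variable (h : dI ≤ dO * dE)

theorem continuous_firstColumns : Continuous (firstColumns h) :=
  continuous_matrix fun x _ => continuous_subtype_val.matrix_elem x _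

theorem haarIntegrable_of_continuous {f : Matrix (Fin dO × Fin dE) (Fin dI) ℂ → ℝ}
    (hf : Continuous f) : HaarIntegrable h f :=
  integrable_haarUnitary (hf.comp (continuous_firstColumns h))

theorem haarIntegrable_bestDist2 {ρ : Matrix (Fin dE) (Fin dE) ℂ} (hρ : ρ.PosSemidef) :
    HaarIntegrable h (bestDist2 ρ) := by
  obtain ⟨P, a, ha, hP⟩ := exists_antitone_diagonalization hρ
  simp_rw [funext (bestDist2_eq P ha hP)]
  refine haarIntegrable_of_continuous h (((continuous_purity.mul continuous_const).add
    (continuous_choiNormSq.pow 2)).sub (continuous_const.mul (continuous_finsetSum _ fun k _ =>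
      continuous_const.mul ((continuous_choiEig k).pow 2))))

theorem choiNormSq_firstColumns (U : Matrix.unitaryGroup (Fin dO × Fin dE) ℂ) :
    choiNormSq (firstColumns h U) = dI := by
  have hcol : ∀ i, ∑ x, star ((U : Matrix (Fin dO × Fin dE) (Fin dO × Fin dE) ℂ) x i) *
      (U : Matrix (Fin dO × Fin dE) (Fin dO × Fin dE) ℂ) x i = 1 := by
    intro i
    have h := congrFun (congrFun (Matrix.mem_unitaryGroup_iff'.1 U.2) i) i
    simpa only [Matrix.mul_apply, Matrix.one_apply_eq, Matrix.star_apply] using h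
  have hsum : star (choiVec (firstColumns h U)) ⬝ᵥ choiVec (firstColumns h U) =
      ∑ i : Fin dI, ∑ x, star ((U : Matrix (Fin dO × Fin dE) (Fin dO × Fin dE) ℂ) x
        (finProdFinEquiv.symm (Fin.castLE h i))) *
          (U : Matrix (Fin dO × Fin dE) (Fin dO × Fin dE) ℂ) x
            (finProdFinEquiv.symm (Fin.castLE h i)) := by
    simp only [dotProduct, Fintype.sum_prod_type]
    rfl
  rw [choiNormSq, hsum]
  simp_rw [hcol]
  simp

/-- The mean squared `k`-th eigenvalue of the Choi operator. -/
noncomputable def meanEigSq (k : ℕ) : ℝ := haarExp h fun V => choiEig V k ^ 2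

theorem haarIntegrable_choiEig_sq (k : ℕ) : HaarIntegrable h fun V => choiEig V k ^ 2 :=
  haarIntegrable_of_continuous h ((continuous_choiEig k).pow 2)

theorem meanEigSq_nonneg (k : ℕ) : 0 ≤ meanEigSq h k :=
  integral_nonneg fun _ => sq_nonneg _

theorem meanEigSq_antitone : Antitone (meanEigSq h) := fun k l hkl =>
  integral_mono (haarIntegrable_choiEig_sq h l) (haarIntegrable_choiEig_sq h k)
    fun U => choiEig_sq_antitone (firstColumns h U) hkl

theorem meanEigSq_eq_zero_of_env_le {k : ℕ} (hk : dE ≤ k) : meanEigSq h k = 0 := by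
  simp [meanEigSq, haarExp, choiEig_eq_zero_of_env_le _ hk]

theorem meanEigSq_eq_zero_of_le {k : ℕ} (hk : Fintype.card (Fin dI × Fin dO) ≤ k) :
    meanEigSq h k = 0 := by
  simp [meanEigSq, haarExp, choiEig_eq_zero_of_le _ hk]

theorem sum_haarExp_orderedEig_sq :
    ∑ i, haarExp h (fun V => orderedEig V i ^ 2) ^ 2 =
      ∑ k ∈ Finset.range dE, meanEigSq h k ^ 2 := by
  simp_rw [orderedEig_eq]
  refine (Fin.sum_univ_eq_sum_range (fun k => meanEigSq h k ^ 2) _).trans ?_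
  -- One sum has `d_I d_O` terms, the other `d_E`; past either length all terms vanish.
  refine sum_range_congr_of_eventually_zero ?_ ?_
  · intro k hk; simp [meanEigSq_eq_zero_of_le h hk]
  · intro k hk; simp [meanEigSq_eq_zero_of_env_le h hk]

theorem haarExp_purity_eq_sum :
    haarExp h purity = ∑ k ∈ Finset.range dE, meanEigSq h k := by
  simp only [haarExp, purity_eq_sum, meanEigSq]
  exact integral_finsetSum _ fun k _ => haarIntegrable_choiEig_sq h k

theorem appError_eq {ρ : Matrix (Fin dE) (Fin dE) ℂ} (P : Matrix.unitaryGroup (Fin dE) ℂ)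
    {a : ℕ → ℝ} (ha : Antitone a)
    (hρ : ρ = (P : Matrix (Fin dE) (Fin dE) ℂ) *
      Matrix.diagonal (fun i => ((a (eigIndex i) : ℝ) : ℂ)) * (P : Matrix (Fin dE) (Fin dE) ℂ)ᴴ) :
    appError h ρ = haarExp h purity * ∑ k ∈ Finset.range dE, a k ^ 2 + (dI : ℝ) ^ 2 -
      2 * ∑ k ∈ Finset.range dE, a k * meanEigSq h k := by
  have hE : ∀ k ∈ Finset.range dE, Integrable (fun U : Matrix.unitaryGroup (Fin dO × Fin dE) ℂ =>
      a k * choiEig (firstColumns h U) k ^ 2) (haarUnitary _) :=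
    fun k _ => Integrable.const_mul (haarIntegrable_choiEig_sq h k) (a k)
  have hp : Integrable (fun U : Matrix.unitaryGroup (Fin dO × Fin dE) ℂ =>
      purity (firstColumns h U)) (haarUnitary _) := haarIntegrable_of_continuous h continuous_purity
  have hc : Integrable (fun U : Matrix.unitaryGroup (Fin dO × Fin dE) ℂ =>
      purity (firstColumns h U) * ∑ k ∈ Finset.range dE, a k ^ 2 + (dI : ℝ) ^ 2)
      (haarUnitary _) := (hp.mul_const _).add (integrable_const _)
  rw [appError, haarExp]
  simp_rw [bestDist2_eq P ha hρ, choiNormSq_firstColumns]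
  rw [integral_sub hc ((integrable_finsetSum _ hE).const_mul 2),
    integral_add (hp.mul_const _) (integrable_const _), integral_mul_const, integral_const_mul,
    integral_finsetSum _ hE]
  simp_rw [integral_const_mul]
  simp [haarExp, meanEigSq]

/-- Complete the square in each `a k` separately; the constraint of unit trace plays no role. -/
theorem appError_ge {ρ : Matrix (Fin dE) (Fin dE) ℂ} (hρ : ρ.PosSemidef)
    (hpos : 0 < haarExp h (purity (dI := dI) (dO := dO) (dE := dE))) :
    (dI : ℝ) ^ 2 - (∑ k ∈ Finset.range dE, meanEigSq h k ^ 2) / haarExp h purity ≤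
      appError h ρ := by
  obtain ⟨P, a, ha, hP⟩ := exists_antitone_diagonalization hρ
  rw [appError_eq h P ha hP]
  set p := haarExp h (purity (dI := dI) (dO := dO) (dE := dE))
  have hk : ∀ k, 2 * (a k * meanEigSq h k) - p * a k ^ 2 ≤ meanEigSq h k ^ 2 / p := by
    intro k
    rw [le_div_iff₀ hpos]
    nlinarith [sq_nonneg (p * a k - meanEigSq h k)]
  have hs := Finset.sum_le_sum fun k (_ : k ∈ Finset.range dE) => hk k
  rw [Finset.sum_sub_distrib, ← Finset.mul_sum, ← Finset.mul_sum, ← Finset.sum_div] at hs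
  linarith

/-- The optimal state to append. -/
noncomputable def optState : Matrix (Fin dE) (Fin dE) ℂ :=
  Matrix.diagonal fun i => ((meanEigSq h (eigIndex i) / haarExp h purity : ℝ) : ℂ)

theorem optState_mem (hpos : 0 < haarExp h (purity (dI := dI) (dO := dO) (dE := dE))) :
    optState h ∈ densityMatrices dE := by
  constructor
  · refine Matrix.PosSemidef.diagonal fun i => ?_
    exact Complex.zero_le_real.2 (div_nonneg (meanEigSq_nonneg h _) hpos.le)
  · rw [optState, Matrix.trace_diagonal, ← Complex.ofReal_sum, ← Finset.sum_div,
      -- The unit trace is the identity `p = ∑ m_k`.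
      sum_eigIndex (meanEigSq h), Fintype.card_fin, ← haarExp_purity_eq_sum, div_self hpos.ne']
    simp

theorem appError_optState (hpos : 0 < haarExp h (purity (dI := dI) (dO := dO) (dE := dE))) :
    appError h (optState h) =
      (dI : ℝ) ^ 2 - (∑ k ∈ Finset.range dE, meanEigSq h k ^ 2) / haarExp h purity := by
  have ha : Antitone fun k => meanEigSq h k / haarExp h purity := fun k l hkl =>
    div_le_div_of_nonneg_right (meanEigSq_antitone h hkl) hpos.le
  rw [appError_eq h 1 ha (by simp [optState])]
  set p := haarExp h (purity (dI := dI) (dO := dO) (dE := dE))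
  simp_rw [div_pow, div_mul_eq_mul_div, ← pow_two]
  rw [← Finset.sum_div, ← Finset.sum_div]
  field_simp
  ring

theorem maxMixed_mem (hE : 1 ≤ dE) : maxMixed dE ∈ densityMatrices dE := by
  have hd : (dE : ℂ) ≠ 0 := Nat.cast_ne_zero.2 (by omega)
  constructor
  · have h0 : (0 : ℂ) ≤ (dE : ℂ)⁻¹ := by
      simp
    exact Matrix.PosSemidef.one.smul h0
  · simp [maxMixed, hd]

theorem appError_maxMixed (hE : 1 ≤ dE) :
    appError h (maxMixed dE) = (dI : ℝ) ^ 2 - 1 / (dE : ℝ) * haarExp h purity := by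
  have hd : (dE : ℝ) ≠ 0 := Nat.cast_ne_zero.2 (by omega)
  rw [appError_eq h 1 (antitone_const (c := (dE : ℝ)⁻¹)) (by
    ext i j
    by_cases hij : i = j <;> simp [maxMixed, hij])]
  rw [← Finset.mul_sum, ← haarExp_purity_eq_sum]
  simp only [Finset.sum_const, Finset.card_range, nsmul_eq_mul]
  field_simp
  ring

/-! ### The average purity in closed form -/

/-- If `o ≠ o'` and `e ≠ e'`, the four rows are distinct and the moment vanishes. If both pairs
agree, the diagonal moment is the sum of the other two, so one formula with two indicators covers
all cases. -/
theorem haarMoment_block (i j : Fin dO × Fin dE) (hn : 2 ≤ Fintype.card (Fin dO × Fin dE))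
    (o o' : Fin dO) (e e' : Fin dE) :
    haarMoment i j (o, e) (o', e) (o', e') (o, e') =
      (if o = o' then exchangeMoment (if i = j then 1 else 0) (Fintype.card (Fin dO × Fin dE))
        else 0) +
      (if e = e' then crossMoment (if i = j then 1 else 0) (Fintype.card (Fin dO × Fin dE))
        else 0) := by
  obtain ⟨h1, h2, h3⟩ := haarMoment_values i j hn
  by_cases ho : o = o'
  · subst ho
    by_cases he : e = e'
    · subst he
      rw [h3, if_pos rfl, if_pos rfl, add_comm]
    · rw [h2 _ _ (by simp [he]), if_pos rfl, if_neg he, add_zero]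
  · by_cases he : e = e'
    · subst he
      rw [h1 _ _ (by simp [ho]), if_neg ho, if_pos rfl, zero_add]
    · rw [if_neg ho, if_neg he, add_zero]
      exact haarMoment_eq_zero (by simp [Ne.symm ho]) (by simp [Ne.symm ho]) (by simp [Ne.symm he])

theorem sum_haarMoment_block (i j : Fin dO × Fin dE) (hn : 2 ≤ Fintype.card (Fin dO × Fin dE)) :
    ∑ o, ∑ o', ∑ e, ∑ e', haarMoment i j (o, e) (o', e) (o', e') (o, e') =
      dO * (dE : ℝ) ^ 2 *
        exchangeMoment (if i = j then 1 else 0) (Fintype.card (Fin dO × Fin dE)) +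
      (dO : ℝ) ^ 2 * dE *
        crossMoment (if i = j then 1 else 0) (Fintype.card (Fin dO × Fin dE)) := by
  simp_rw [haarMoment_block i j hn, Finset.sum_add_distrib]
  simp
  ring

theorem purity_firstColumns (U : Matrix.unitaryGroup (Fin dO × Fin dE) ℂ) :
    purity (firstColumns h U) = ∑ i : Fin dI, ∑ j : Fin dI, ∑ o, ∑ o', ∑ e, ∑ e',
      (U.1 (o, e) (finProdFinEquiv.symm (Fin.castLE h i)) *
        star (U.1 (o', e) (finProdFinEquiv.symm (Fin.castLE h j))) *
        U.1 (o', e') (finProdFinEquiv.symm (Fin.castLE h j)) *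
        star (U.1 (o, e') (finProdFinEquiv.symm (Fin.castLE h i)))).re := by
  simp only [purity, Matrix.trace, Matrix.diag_apply, Matrix.mul_apply, choiOp, partialTraceRight,
    choiProj, Matrix.of_apply, Matrix.vecMulVec_apply, Pi.star_apply, choiVec, firstColumns,
    Fintype.sum_prod_type, Finset.sum_mul_sum, Complex.re_sum]
  refine Finset.sum_congr rfl fun i _ => ?_
  rw [Finset.sum_comm]
  refine Finset.sum_congr rfl fun j _ => Finset.sum_congr rfl fun o _ =>
    Finset.sum_congr rfl fun o' _ => Finset.sum_congr rfl fun e _ =>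
    Finset.sum_congr rfl fun e' _ => ?_
  rw [← mul_assoc]

theorem sq_mul_sq_sub_one_pos {a b : ℕ} (ha : 2 ≤ a) (hb : 1 ≤ b) :
    0 < (a : ℝ) ^ 2 * (b : ℝ) ^ 2 - 1 := by
  have h2 : (2 : ℝ) ≤ a * b := by exact_mod_cast Nat.mul_le_mul ha hb
  nlinarith

theorem haarExp_purity (hO : 2 ≤ dO) (hE : 1 ≤ dE) :
    haarExp h purity = ((dI : ℝ) * dO * ((dE : ℝ) ^ 2 - 1) +
      (dI : ℝ) ^ 2 * dE * ((dO : ℝ) ^ 2 - 1)) / ((dO : ℝ) ^ 2 * (dE : ℝ) ^ 2 - 1) := by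
  have hn : 2 ≤ Fintype.card (Fin dO × Fin dE) := by
    simp only [Fintype.card_prod, Fintype.card_fin]
    nlinarith
  have hint := fun i j p q r s : Fin dO × Fin dE => integrable_haarUnitary
    (continuous_haarMoment_integrand i j p q r s)
  have hexp : haarExp h purity = ∑ i : Fin dI, ∑ j : Fin dI, ∑ o, ∑ o', ∑ e, ∑ e',
      haarMoment (finProdFinEquiv.symm (Fin.castLE h i)) (finProdFinEquiv.symm (Fin.castLE h j))
        (o, e) (o', e) (o', e') (o, e') := by
    simp only [haarExp, purity_firstColumns, haarMoment]
    iterate 6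
      refine (integral_finsetSum _ fun _ _ => ?_).trans (Finset.sum_congr rfl fun _ _ => ?_)
      · repeat' refine integrable_finsetSum _ fun _ _ => ?_
        exact hint _ _ _ _ _ _
    rfl
  have hinj : ∀ i j : Fin dI, finProdFinEquiv.symm (Fin.castLE h i) =
      finProdFinEquiv.symm (Fin.castLE h j) ↔ i = j := fun i j =>
    (finProdFinEquiv.symm.injective.comp (Fin.castLE_injective h)).eq_iff
  rw [hexp]
  simp_rw [sum_haarMoment_block _ _ hn, hinj]
  -- The second summand is the value for distinct columns, the first the excess on the diagonal `i =
  -- j`; they contribute `d_I²` and `d_I` times.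
  have hsplit : ∀ i j : Fin dI, dO * (dE : ℝ) ^ 2 *
        exchangeMoment (if i = j then 1 else 0) (Fintype.card (Fin dO × Fin dE)) +
      (dO : ℝ) ^ 2 * dE *
        crossMoment (if i = j then 1 else 0) (Fintype.card (Fin dO × Fin dE)) =
      (if i = j then dO * ((dE : ℝ) ^ 2 - 1) / ((dO : ℝ) ^ 2 * (dE : ℝ) ^ 2 - 1) else 0) +
        dE * ((dO : ℝ) ^ 2 - 1) / ((dO : ℝ) ^ 2 * (dE : ℝ) ^ 2 - 1) := by
    have hD : (dO : ℝ) ^ 2 * (dE : ℝ) ^ 2 - 1 ≠ 0 := (sq_mul_sq_sub_one_pos hO hE).ne'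
    have hO0 : (dO : ℝ) ≠ 0 := Nat.cast_ne_zero.2 (by omega)
    have hE0 : (dE : ℝ) ≠ 0 := Nat.cast_ne_zero.2 (by omega)
    intro i j
    simp only [exchangeMoment, crossMoment, Fintype.card_prod, Fintype.card_fin, Nat.cast_mul,
      mul_pow]
    split_ifs <;> field_simp <;> ring
  simp_rw [hsplit, Finset.sum_add_distrib]
  simp
  ring

theorem haarExp_purity_pos (hI : 1 ≤ dI) (hO : 2 ≤ dO) (hE : 1 ≤ dE) :
    0 < haarExp h (purity (dI := dI) (dO := dO) (dE := dE)) := by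
  rw [haarExp_purity h hO hE]
  have hI' : (1 : ℝ) ≤ dI := by exact_mod_cast hI
  have hO' : (2 : ℝ) ≤ dO := by exact_mod_cast hO
  have hE' : (1 : ℝ) ≤ dE := by exact_mod_cast hE
  have h1 : 0 ≤ (dE : ℝ) ^ 2 - 1 := by nlinarith
  have h2 : 0 < (dO : ℝ) ^ 2 - 1 := by nlinarith
  exact div_pos (by positivity) (sq_mul_sq_sub_one_pos hO hE)

/-! ### The minimal error and its bounds -/

theorem isLeast_appError (hpos : 0 < haarExp h (purity (dI := dI) (dO := dO) (dE := dE))) :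
    IsLeast (appError h '' densityMatrices dE)
      ((dI : ℝ) ^ 2 - (∑ k ∈ Finset.range dE, meanEigSq h k ^ 2) / haarExp h purity) := by
  refine ⟨⟨optState h, optState_mem h hpos, appError_optState h hpos⟩, ?_⟩
  rintro _ ⟨ρ, hρ, rfl⟩
  exact appError_ge h hρ.1 hpos

theorem epsApp_eq (hpos : 0 < haarExp h (purity (dI := dI) (dO := dO) (dE := dE))) :
    epsApp h =
      (dI : ℝ) ^ 2 - (∑ k ∈ Finset.range dE, meanEigSq h k ^ 2) / haarExp h purity :=
  (isLeast_appError h hpos).csInf_eq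

theorem le_epsApp (hpos : 0 < haarExp h (purity (dI := dI) (dO := dO) (dE := dE))) :
    (dI : ℝ) ^ 2 - haarExp h purity ≤ epsApp h := by
  rw [epsApp_eq h hpos]
  refine sub_le_sub_left ?_ _
  rw [div_le_iff₀ hpos, ← pow_two, haarExp_purity_eq_sum]
  exact Finset.sum_sq_le_sq_sum_of_nonneg fun k _ => meanEigSq_nonneg h k

end Averages

end AppendEnv

theorem mainTheorem4 (dI dO dE : ℕ) (hI : 1 ≤ dI) (hO : 2 ≤ dO) (hE : 1 ≤ dE)
    (h : dI ≤ dO * dE) :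
    -- the minimum over the environment unitaries is attained
    (∀ ρ ∈ AppendEnv.densityMatrices dE, ∀ V : Matrix (Fin dO × Fin dE) (Fin dI) ℂ,
      IsLeast (Set.range (AppendEnv.dist2 ρ V)) (AppendEnv.bestDist2 ρ V)) ∧
    -- the expectations are well defined
    (∀ ρ ∈ AppendEnv.densityMatrices dE,
      AppendEnv.HaarIntegrable h (AppendEnv.bestDist2 ρ)) ∧
    (∀ i, AppendEnv.HaarIntegrable h (fun V => AppendEnv.orderedEig V i ^ 2)) ∧
    AppendEnv.HaarIntegrable h AppendEnv.purity ∧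
    -- the minimum over the appended states is attained
    IsLeast (AppendEnv.appError h '' AppendEnv.densityMatrices dE) (AppendEnv.epsApp h) ∧
    -- the average purity
    AppendEnv.haarExp h AppendEnv.purity =
      ((dI : ℝ) * dO * ((dE : ℝ) ^ 2 - 1) + (dI : ℝ) ^ 2 * dE * ((dO : ℝ) ^ 2 - 1)) /
        ((dO : ℝ) ^ 2 * (dE : ℝ) ^ 2 - 1) ∧
    -- the minimal error, in terms of the average purity and explicitly
    AppendEnv.epsApp h = (dI : ℝ) ^ 2 -
      (∑ i, AppendEnv.haarExp h (fun V => AppendEnv.orderedEig V i ^ 2) ^ 2) /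
        AppendEnv.haarExp h AppendEnv.purity ∧
    AppendEnv.epsApp h = (dI : ℝ) ^ 2 -
      ((dO : ℝ) ^ 2 * (dE : ℝ) ^ 2 - 1) /
        ((dI : ℝ) * dO * ((dE : ℝ) ^ 2 - 1) + (dI : ℝ) ^ 2 * dE * ((dO : ℝ) ^ 2 - 1)) *
      ∑ i, AppendEnv.haarExp h (fun V => AppendEnv.orderedEig V i ^ 2) ^ 2 ∧
    -- the two-sided bounds
    (dI : ℝ) ^ 2 -
      ((dI : ℝ) * dO * ((dE : ℝ) ^ 2 - 1) + (dI : ℝ) ^ 2 * dE * ((dO : ℝ) ^ 2 - 1)) /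
        ((dO : ℝ) ^ 2 * (dE : ℝ) ^ 2 - 1) ≤ AppendEnv.epsApp h ∧
    AppendEnv.epsApp h ≤ (dI : ℝ) ^ 2 - 1 / (dE : ℝ) *
      (((dI : ℝ) * dO * ((dE : ℝ) ^ 2 - 1) + (dI : ℝ) ^ 2 * dE * ((dO : ℝ) ^ 2 - 1)) /
        ((dO : ℝ) ^ 2 * (dE : ℝ) ^ 2 - 1)) ∧
    -- the maximally mixed state is a state whose error is exactly the upper bound
    AppendEnv.maxMixed dE ∈ AppendEnv.densityMatrices dE ∧
    AppendEnv.appError h (AppendEnv.maxMixed dE) = (dI : ℝ) ^ 2 - 1 / (dE : ℝ) *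
      (((dI : ℝ) * dO * ((dE : ℝ) ^ 2 - 1) + (dI : ℝ) ^ 2 * dE * ((dO : ℝ) ^ 2 - 1)) /
        ((dO : ℝ) ^ 2 * (dE : ℝ) ^ 2 - 1)) := by
  have hpos := AppendEnv.haarExp_purity_pos h hI hO hE
  have hleast := AppendEnv.isLeast_appError h hpos
  have hpur := AppendEnv.haarExp_purity h hO hE
  have heps : AppendEnv.epsApp h = (dI : ℝ) ^ 2 -
      (∑ i, AppendEnv.haarExp h (fun V => AppendEnv.orderedEig V i ^ 2) ^ 2) /
        AppendEnv.haarExp h AppendEnv.purity := by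
    rw [AppendEnv.sum_haarExp_orderedEig_sq, AppendEnv.epsApp_eq h hpos]
  have hmix := AppendEnv.appError_maxMixed h hE
  refine ⟨fun ρ hρ V => ?_, fun ρ hρ => AppendEnv.haarIntegrable_bestDist2 h hρ.1, fun i => ?_,
    AppendEnv.haarIntegrable_of_continuous h AppendEnv.continuous_purity, ?_, hpur, heps, ?_, ?_,
    ?_, AppendEnv.maxMixed_mem hE, ?_⟩
  · obtain ⟨P, a, ha, hP⟩ := AppendEnv.exists_antitone_diagonalization hρ.1
    rw [AppendEnv.bestDist2_eq P ha hP]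
    exact AppendEnv.isLeast_dist2 P ha hP V
  · simp_rw [AppendEnv.orderedEig_eq]
    exact AppendEnv.haarIntegrable_choiEig_sq h i
  · rw [AppendEnv.epsApp_eq h hpos]
    exact hleast
  · rw [heps, hpur, div_div_eq_mul_div, mul_comm, mul_div_assoc, mul_comm]
    ring
  · rw [← hpur]
    exact AppendEnv.le_epsApp h hpos
  · rw [← hpur, ← hmix, AppendEnv.epsApp_eq h hpos]
    -- The maximally mixed state is one competitor in the minimum.
    exact AppendEnv.appError_ge h (AppendEnv.maxMixed_mem hE).1 hpos
  · rw [hmix, hpur]
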